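/- Let $w\ge 1$, let $(V_i)_{i\ge 1}=((\tilde X_i,\tilde Y_i))_{i\ge1}$ be a sequence of random variables with values in $\mathbb R^w\times\mathbb R$, let $F(\cdot\mid x)$ be the distribution function of a regular version of the conditional law of $\tilde Y_1$ given $\tilde X_1=x$, and fix $\tilde x\in\mathbb R^w$. Assume the following, for some $\delta>0$. 1. (Mixing) $(V_i)$ is strictly stationary and strongly mixing with $\alpha(\tau)=\mathcal O(\tau^{-(2+\delta)})$, where $$\alpha(\tau)=\sup_{m\ge1}\ \sup\{|\mathbb P(A\cap B)-\mathbb P(A)\mathbb P(B)|:\ A\in\sigma(V_i,\,i\le m),\ B\in\sigma(V_i,\,i\ge m+\tau)\}.$$ 2. (Smoothness) For every $y\in\mathbb R$, $0<F(y\mid\tilde x)<1$ and $x\mapsto F(y\mid x)$ is twice continuously differentiable at $\tilde x$ (that is, in a neighbourhood of $\tilde x$). The law of $\tilde X_1$ has a Lebesgue density $g$ with $g(\tilde x)>0$ and $g$ continuous at $\tilde x$. There are $M>0$ and $i_0$ such that for all $i\ge i_0$ the pair $(\tilde X_1,\tilde X_i)$ has a density $g_{1,i}$ with $|g_{1,i}(u,v)-g(u)g(v)|\le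 M$ for all $u,v$. 3. (Kernel) $K:\mathbb R^w\to\mathbb R$ is nonnegative, bounded, continuous and compactly supported, with $\int K=1$, $\int uK(u)\,du=0$, $\int uu^\top K(u)\,du=\mu_2I$, $\int K^2=\nu_0$ and $\int uu^\top K^2(u)\,du=\nu_2I$ for some $\mu_2,\nu_0,\nu_2\in(0,\infty)$. 4. (Bandwidth) $h=h_n>0$, $h\to0$ and $nh^{w(1+2/\delta)}\to\infty$ as $n\to\infty$. Put $K_h(u)=h^{-w}K(h^{-1}u)$. Let $(p_i)_{i=1}^n$ maximize $\sum_{i=1}^n\log p_i$ (with $\log 0=-\infty$) subject to $p_i\ge0$, $\sum_ip_i=1$ and $\sum_ip_i(\tilde X_i-\tilde x)K_h(\tilde X_i-\tilde x)=0$; for samples that admit no maximizer of finite log-likelihood, set $p_i=1/n$ by convention. The reweighted Nadaraya–Watson estimator is $$\widehat F(b\mid\tilde x)=\frac{\sum_{i=1}^np_iK_h(\tilde X_i-\tilde x)\,\mathbf 1(\tilde Y_i\le b)}{\sum_{i=1}^np_iK_h(\tilde X_i-\tilde x)},$$ (with the value $0$ if the denominator vanishes). For $\beta\in(0,1)$ put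 $\widehat Q_\beta(\tilde x)=\inf\{y\in\mathbb R:\widehat F(y\mid\tilde x)\ge\beta\}$ (with the value $0$ if this set is empty) and $Q_\beta(\tilde x)=\inf\{y\in\mathbb R:F(y\mid\tilde x)\ge\beta\}$. Then for every $\beta\in(0,1)$ for which the conditional $\beta$-quantile is unique, i.e. $F(y\mid\tilde x)>\beta$ for all $y>Q_\beta(\tilde x)$, $$\widehat Q_\beta(\tilde x)\to Q_\beta(\tilde x)\quad\text{in probability as }n\to\infty .$$ -/

import Mathlib

open MeasureTheory ProbabilityTheory Filter Topology Asymptotics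
open scoped ENNReal

namespace RNW

/-! ### Strict stationarity and strong mixing -/

section TimeSeries

variable {Ω S : Type*} [MeasurableSpace Ω] [MeasurableSpace S]

/-- Strict stationarity: the law of the whole path is invariant under time shifts. -/
def IsStationary (V : ℕ → Ω → S) (μ : Measure Ω) : Prop :=
  ∀ k : ℕ, μ.map (fun ω (i : ℕ) => V (i + k) ω) = μ.map (fun ω (i : ℕ) => V i ω)

/-- The σ-algebra generated by `V 0, …, V m`. -/
abbrev pastSigma (V : ℕ → Ω → S) (m : ℕ) : MeasurableSpace Ω :=
  ⨆ i : ℕ, ⨆ _ : i ≤ m, MeasurableSpace.comap (V i) inferInstance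

/-- The σ-algebra generated by `V m, V (m+1), …`. -/
abbrev futureSigma (V : ℕ → Ω → S) (m : ℕ) : MeasurableSpace Ω :=
  ⨆ i : ℕ, ⨆ _ : m ≤ i, MeasurableSpace.comap (V i) inferInstance

/-- The strong mixing coefficient `α(τ)`: the supremum of `|ℙ(A ∩ B) - ℙ(A) ℙ(B)|` over all events
`A` of the past up to some time `m` and all events `B` of the future from time `m + τ` on.
(For a stationary process this is the coefficient of its two-sided extension.) -/
noncomputable def mixingCoeff (V : ℕ → Ω → S) (μ : Measure Ω) (τ : ℕ) : ℝ :=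
  sSup {r : ℝ | ∃ (m : ℕ) (A B : Set Ω), MeasurableSet[pastSigma V m] A ∧
    MeasurableSet[futureSigma V (m + τ)] B ∧ r = |μ.real (A ∩ B) - μ.real A * μ.real B|}

/-- Stationarity, together with `α(τ) = O(τ ^ (-(2 + δ)))` as `τ → ∞`. -/
structure MixingAssumption (V : ℕ → Ω → S) (μ : Measure Ω) (δ : ℝ) : Prop where
  stationary : IsStationary V μ
  mixing : (fun τ : ℕ => mixingCoeff V μ τ) =O[atTop] fun τ : ℕ => (τ : ℝ) ^ (-(2 + δ))

end TimeSeries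

/-! ### The conditional distribution function, its quantiles, and the smoothness assumption -/

/-- The conditional distribution function `F(b | x)` belonging to a conditional law `κ`. -/
noncomputable def condCDF {E : Type*} [MeasurableSpace E] (κ : Kernel E ℝ) (b : ℝ) (x : E) : ℝ :=
  (κ x).real (Set.Iic b)

/-- The generalized inverse `inf {y | β ≤ G y}`. -/
noncomputable def quantile (G : ℝ → ℝ) (β : ℝ) : ℝ :=
  sInf {y : ℝ | β ≤ G y}

/-- `f` is a (version of the) density of `ν` with respect to Lebesgue measure. -/
structure IsDensity {E : Type*} [MeasureSpace E] (ν : Measure E) (f : E → ℝ) : Prop where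
  measurable : Measurable f
  nonneg : ∀ x, 0 ≤ f x
  eq_withDensity : ν = volume.withDensity fun x => ENNReal.ofReal (f x)

/-- Smoothness of the conditional distribution function and of the densities at the point `x`.
Here `κ` is the conditional law of the response given the predictor, `g` is the density of the
predictor, and time starts at `0`.  The bound on the joint densities is required for all
sufficiently large lags. -/
structure SmoothnessAssumption {Ω : Type*} [MeasurableSpace Ω] {w : ℕ} (μ : Measure Ω)
    (X : ℕ → Ω → EuclideanSpace ℝ (Fin w)) (κ : Kernel (EuclideanSpace ℝ (Fin w)) ℝ)
    (g : EuclideanSpace ℝ (Fin w) → ℝ) (x : EuclideanSpace ℝ (Fin w)) : Prop where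
  cdf_pos : ∀ y : ℝ, 0 < condCDF κ y x
  cdf_lt_one : ∀ y : ℝ, condCDF κ y x < 1
  cdf_smooth : ∀ y : ℝ, ContDiffAt ℝ 2 (condCDF κ y) x
  density_pos : 0 < g x
  density_continuousAt : ContinuousAt g x
  joint_density : ∃ M : ℝ, 0 < M ∧ ∃ i₀ : ℕ, ∀ i : ℕ, i₀ ≤ i →
    ∃ g₂ : EuclideanSpace ℝ (Fin w) × EuclideanSpace ℝ (Fin w) → ℝ,
      IsDensity (μ.map fun ω => (X 0 ω, X i ω)) g₂ ∧ ∀ u v, |g₂ (u, v) - g u * g v| ≤ M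

/-! ### Kernel function and bandwidth -/

/-- Regularity of the smoothing kernel `K`. -/
structure KernelAssumption {w : ℕ} (K : EuclideanSpace ℝ (Fin w) → ℝ) : Prop where
  nonneg : ∀ u, 0 ≤ K u
  bounded : ∃ C : ℝ, ∀ u, K u ≤ C
  continuous : Continuous K
  compactSupport : HasCompactSupport K
  integral_eq_one : ∫ u, K u = 1
  first_moment : ∫ u, K u • u = 0
  second_moment : ∃ μ₂ : ℝ, 0 < μ₂ ∧
    ∀ j k : Fin w, ∫ u, u j * u k * K u = if j = k then μ₂ else 0
  sq_integral : ∃ ν₀ : ℝ, 0 < ν₀ ∧ ∫ u, K u ^ 2 = ν₀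
  sq_second_moment : ∃ ν₂ : ℝ, 0 < ν₂ ∧
    ∀ j k : Fin w, ∫ u, u j * u k * K u ^ 2 = if j = k then ν₂ else 0

/-- Bandwidths `h n > 0` with `h n → 0` and `n * h n ^ (w (1 + 2 / δ)) → ∞`. -/
structure BandwidthAssumption (w : ℕ) (δ : ℝ) (h : ℕ → ℝ) : Prop where
  pos : ∀ n, 0 < h n
  tendsto_zero : Tendsto h atTop (𝓝 0)
  tendsto_atTop : Tendsto (fun n : ℕ => (n : ℝ) * h n ^ ((w : ℝ) * (1 + 2 / δ))) atTop atTop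

/-! ### The reweighted Nadaraya–Watson estimator -/

section Estimator

variable {w n : ℕ}

/-- The rescaled kernel `K_h(u) = h⁻ʷ K(h⁻¹ u)`. -/
noncomputable def scaledKernel (K : EuclideanSpace ℝ (Fin w) → ℝ) (h : ℝ)
    (u : EuclideanSpace ℝ (Fin w)) : ℝ :=
  (h ^ w)⁻¹ * K (h⁻¹ • u)

/-- The constraints on the adjustment weights at `x`.  Weights are taken positive, since a vector
with a zero entry has log-likelihood `-∞`. -/
structure IsFeasible (K : EuclideanSpace ℝ (Fin w) → ℝ) (h : ℝ)
    (X : Fin n → EuclideanSpace ℝ (Fin w)) (x : EuclideanSpace ℝ (Fin w))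
    (p : Fin n → ℝ) : Prop where
  pos : ∀ i, 0 < p i
  sum_eq_one : ∑ i, p i = 1
  moment : ∑ i, (p i * scaledKernel K h (X i - x)) • (X i - x) = 0

/-- `p` maximizes the empirical log-likelihood `∑ log p i` under the constraints. -/
structure IsAdjustment (K : EuclideanSpace ℝ (Fin w) → ℝ) (h : ℝ)
    (X : Fin n → EuclideanSpace ℝ (Fin w)) (x : EuclideanSpace ℝ (Fin w))
    (p : Fin n → ℝ) : Prop where
  feasible : IsFeasible K h X x p
  maximal : ∀ q : Fin n → ℝ, IsFeasible K h X x q →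
    ∑ i, Real.log (q i) ≤ ∑ i, Real.log (p i)

open Classical in
/-- The adjustment weights: the maximizer (unique, by strict concavity) if there is one.  By
convention the weights are `1 / n` for samples for which the constraints cannot be met. -/
noncomputable def adjustmentWeights (K : EuclideanSpace ℝ (Fin w) → ℝ) (h : ℝ)
    (X : Fin n → EuclideanSpace ℝ (Fin w)) (x : EuclideanSpace ℝ (Fin w)) : Fin n → ℝ :=
  if hp : ∃ p : Fin n → ℝ, IsAdjustment K h X x p then hp.choose else fun _ => 1 / (n : ℝ)

/-- The final weights `Ŵᵢ(x)`. -/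
noncomputable def finalWeights (K : EuclideanSpace ℝ (Fin w) → ℝ) (h : ℝ)
    (X : Fin n → EuclideanSpace ℝ (Fin w)) (x : EuclideanSpace ℝ (Fin w)) (i : Fin n) : ℝ :=
  adjustmentWeights K h X x i * scaledKernel K h (X i - x) /
    ∑ j, adjustmentWeights K h X x j * scaledKernel K h (X j - x)

/-- The estimated conditional distribution function `F̂(b | x)`. -/
noncomputable def estCDF (K : EuclideanSpace ℝ (Fin w) → ℝ) (h : ℝ)
    (X : Fin n → EuclideanSpace ℝ (Fin w)) (Y : Fin n → ℝ)
    (x : EuclideanSpace ℝ (Fin w)) (b : ℝ) : ℝ :=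
  ∑ i, finalWeights K h X x i * (Set.Iic b).indicator (fun _ => (1 : ℝ)) (Y i)

/-- The estimated conditional quantile `Q̂_β(x)`. -/
noncomputable def estQuantile (K : EuclideanSpace ℝ (Fin w) → ℝ) (h : ℝ)
    (X : Fin n → EuclideanSpace ℝ (Fin w)) (Y : Fin n → ℝ)
    (x : EuclideanSpace ℝ (Fin w)) (β : ℝ) : ℝ :=
  quantile (estCDF K h X Y x) β

end Estimator

end RNW

/- The local averages `(n h^w)⁻¹ ∑ ψ(Y i) φ((X i - x) / h)` converge in probability to
`(∫ φ) g(x) E[ψ(Y) | X = x]`. Indeed, a covariance of two summands is bounded both by mixing and,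
the pairs of predictors having locally bounded densities, by the smallness of the window. The
geometric mean of the two bounds is summable over the lags once `√α` is, so that
`n h^w → ∞` suffices.

The adjustment weights are `p i = n⁻¹ (1 + ⟪l, W i⟫)⁻¹` with `W i = K(U i) U i` and
`U i = (X i - x) / h`, where `l` is a critical point of the concave function
`l ↦ ∑ log (1 + ⟪l, W i⟫)`. As the local averages of the `W i` tend to zero while those of their
outer products have a positive definite limit, this function has a maximum inside any small ball
around zero, with high probability. Hence `n * p i → 1` uniformly in `i`, the adjusted estimator has
the same limit `F(b | x)` as the unadjusted one, and its values at the two points `Q ± ε / 2`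
confine its quantile, because it is monotone. -/

namespace RNW

section HighProbability

variable {ι Ω F : Type*} [MeasurableSpace Ω] {μ : Measure Ω} {l : Filter ι}

/-- The filter of the sets of pairs `(i, ω)` whose section at `i` has probability tending to one
along `l`.  An assertion of high probability becomes an `Eventually` along this filter and
convergence in probability an ordinary limit.  The complements of the sections may be
nonmeasurable: their outer measure is what tends to zero. -/
def highProbability (μ : Measure Ω) (l : Filter ι) : Filter (ι × Ω) :=
  comk (fun s => Tendsto (fun i => μ (Prod.mk i ⁻¹' s)) l (𝓝 0))
    (by simpa using tendsto_const_nhds)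
    (fun _ ht _ hst => tendsto_of_tendsto_of_tendsto_of_le_of_le tendsto_const_nhds ht
      (fun _ => zero_le) fun _ => measure_mono (Set.preimage_mono hst))
    (fun _ hs _ ht => tendsto_of_tendsto_of_tendsto_of_le_of_le tendsto_const_nhds
      (zero_add (0 : ℝ≥0∞) ▸ hs.add ht) (fun _ => zero_le) fun _ => measure_union_le _ _)

lemma eventually_highProbability_iff {P : ι × Ω → Prop} :
    (∀ᶠ z in highProbability μ l, P z) ↔ Tendsto (fun i => μ {ω | ¬ P (i, ω)}) l (𝓝 0) :=
  Iff.rfl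

lemma tendsto_fst_highProbability : Tendsto Prod.fst (highProbability μ l) l := by
  intro s hs
  refine eventually_highProbability_iff.2 (tendsto_const_nhds.congr' ?_)
  filter_upwards [hs] with i hi
  simp [hi]

lemma tendstoInMeasure_const_iff [PseudoMetricSpace F] {Z : ι → Ω → F} {L : F} :
    TendstoInMeasure μ Z l (fun _ => L) ↔
      Tendsto (fun z : ι × Ω => Z z.1 z.2) (highProbability μ l) (𝓝 L) := by
  simp only [tendstoInMeasure_iff_dist, Metric.tendsto_nhds, eventually_highProbability_iff,
    not_lt]

lemma tendsto_highProbability_of_variance [IsFiniteMeasure μ] {Z : ι → Ω → ℝ} {L : ℝ}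
    (hZ : ∀ i, MemLp (Z i) 2 μ) (hmean : Tendsto (fun i => ∫ ω, Z i ω ∂μ) l (𝓝 L))
    (hvar : Tendsto (fun i => Var[Z i; μ]) l (𝓝 0)) :
    Tendsto (fun z : ι × Ω => Z z.1 z.2) (highProbability μ l) (𝓝 L) := by
  have hcentered : TendstoInMeasure μ (fun i ω => Z i ω - ∫ ω, Z i ω ∂μ) l (fun _ => 0) := by
    refine tendstoInMeasure_iff_norm.2 fun ε hε => ?_
    have hbound : Tendsto (fun i => ENNReal.ofReal (Var[Z i; μ] / ε ^ 2)) l (𝓝 0) := by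
      simpa using ENNReal.tendsto_ofReal (hvar.div_const (ε ^ 2))
    refine tendsto_of_tendsto_of_tendsto_of_le_of_le tendsto_const_nhds hbound
      (fun _ => zero_le) fun i => ?_
    simpa using meas_ge_le_variance_div_sq (hZ i) hε
  simpa using (tendstoInMeasure_const_iff.1 hcentered).add
    (hmean.comp tendsto_fst_highProbability)

end HighProbability

section Covariance

variable {Ω : Type*} [MeasurableSpace Ω] {μ : Measure Ω} {ξ η : Ω → ℝ} {C D a : ℝ}

lemma integrable_of_mem_Icc [IsFiniteMeasure μ] (hξ : Measurable ξ)
    (hξC : ∀ ω, ξ ω ∈ Set.Icc 0 C) : Integrable ξ μ :=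
  Integrable.of_bound hξ.aestronglyMeasurable C <| ae_of_all _ fun ω => by
    rw [Real.norm_of_nonneg (hξC ω).1]
    exact (hξC ω).2

lemma abs_integral_sub_le_of_superlevel {ν₁ ν₂ : Measure Ω} [IsFiniteMeasure ν₁]
    [IsFiniteMeasure ν₂] (hC : 0 ≤ C) (hξ : Measurable ξ) (hξC : ∀ ω, ξ ω ∈ Set.Icc 0 C)
    (h : ∀ t, |ν₁.real {ω | t ≤ ξ ω} - ν₂.real {ω | t ≤ ξ ω}| ≤ a) :
    |∫ ω, ξ ω ∂ν₁ - ∫ ω, ξ ω ∂ν₂| ≤ C * a := by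
  have layer_cake (ν : Measure Ω) [IsFiniteMeasure ν] :
      ∫ ω, ξ ω ∂ν = ∫ t in Set.Ioc 0 C, ν.real {ω | t ≤ ξ ω} :=
    (integrable_of_mem_Icc hξ hξC).integral_eq_integral_Ioc_meas_le
      (ae_of_all _ fun ω => (hξC ω).1) (ae_of_all _ fun ω => (hξC ω).2)
  have integrableOn_level (ν : Measure Ω) [IsFiniteMeasure ν] :
      IntegrableOn (fun t => ν.real {ω | t ≤ ξ ω}) (Set.Ioc 0 C) := by
    have hanti : Antitone fun t => ν.real {ω | t ≤ ξ ω} := fun s t hst =>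
      measureReal_mono fun ω (hω : t ≤ ξ ω) => hst.trans hω
    exact ((hanti.antitoneOn _).integrableOn_isCompact isCompact_Icc).mono_set
      Set.Ioc_subset_Icc_self
  rw [layer_cake ν₁, layer_cake ν₂,
    ← integral_sub (integrableOn_level ν₁) (integrableOn_level ν₂), ← Real.norm_eq_abs]
  calc ‖∫ t in Set.Ioc 0 C, (ν₁.real {ω | t ≤ ξ ω} - ν₂.real {ω | t ≤ ξ ω})‖
      ≤ a * volume.real (Set.Ioc 0 C) :=
        norm_setIntegral_le_of_norm_le_const (by simp) fun t _ => h t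
    _ = C * a := by simp [hC, mul_comm]

lemma abs_setIntegral_sub_le_of_superlevel [IsFiniteMeasure μ] (hC : 0 ≤ C) (hξ : Measurable ξ)
    (hξC : ∀ ω, ξ ω ∈ Set.Icc 0 C) {B : Set Ω}
    (h : ∀ s, |μ.real ({ω | s ≤ ξ ω} ∩ B) - μ.real {ω | s ≤ ξ ω} * μ.real B| ≤ a) :
    |∫ ω in B, ξ ω ∂μ - (∫ ω, ξ ω ∂μ) * μ.real B| ≤ C * a := by
  have hlevel (s : ℝ) : |(μ.restrict B).real {ω | s ≤ ξ ω}
      - ((μ B).toNNReal • μ).real {ω | s ≤ ξ ω}| ≤ a := by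
    rw [measureReal_restrict_apply (measurableSet_le measurable_const hξ),
      measureReal_nnreal_smul_apply, mul_comm]
    exact h s
  have key := abs_integral_sub_le_of_superlevel hC hξ hξC hlevel
  rwa [integral_smul_nnreal_measure, NNReal.smul_def, smul_eq_mul, mul_comm] at key

lemma abs_integral_mul_sub_le_of_superlevel [IsFiniteMeasure μ] (hC : 0 ≤ C) (hD : 0 ≤ D)
    (hξ : Measurable ξ) (hη : Measurable η) (hξC : ∀ ω, ξ ω ∈ Set.Icc 0 C)
    (hηD : ∀ ω, η ω ∈ Set.Icc 0 D)
    (h : ∀ s t, |μ.real ({ω | s ≤ ξ ω} ∩ {ω | t ≤ η ω})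
      - μ.real {ω | s ≤ ξ ω} * μ.real {ω | t ≤ η ω}| ≤ a) :
    |∫ ω, ξ ω * η ω ∂μ - (∫ ω, ξ ω ∂μ) * ∫ ω, η ω ∂μ| ≤ D * (C * a) := by
  have hξ0 : ∀ ω, 0 ≤ ξ ω := fun ω => (hξC ω).1
  have : IsFiniteMeasure (μ.withDensity fun ω => ENNReal.ofReal (ξ ω)) :=
    isFiniteMeasure_withDensity (integrable_of_mem_Icc hξ hξC).lintegral_lt_top.ne
  have hlevel (t : ℝ) : |(μ.withDensity fun ω => ENNReal.ofReal (ξ ω)).real {ω | t ≤ η ω}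
      - ((∫ ω, ξ ω ∂μ).toNNReal • μ).real {ω | t ≤ η ω}| ≤ C * a := by
    rw [measureReal_nnreal_smul_apply, Real.coe_toNNReal _ (integral_nonneg hξ0), measureReal_def,
      withDensity_apply _ (measurableSet_le measurable_const hη),
      ← integral_eq_lintegral_of_nonneg_ae (ae_of_all _ hξ0) hξ.aestronglyMeasurable]
    exact abs_setIntegral_sub_le_of_superlevel hC hξ hξC fun s => h s t
  have key := abs_integral_sub_le_of_superlevel hD hη hηD hlevel
  rw [integral_smul_nnreal_measure, integral_withDensity_eq_integral_toReal_smul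
    hξ.ennreal_ofReal (ae_of_all _ fun ω => by simp)] at key
  simpa only [ENNReal.toReal_ofReal (hξ0 _), smul_eq_mul, NNReal.smul_def,
    Real.coe_toNNReal _ (integral_nonneg hξ0)] using key

lemma memLp_of_abs_le [IsFiniteMeasure μ] (hξ : Measurable ξ) (hξC : ∀ ω, |ξ ω| ≤ C) (p : ℝ≥0∞) :
    MemLp ξ p μ :=
  MemLp.of_bound hξ.aestronglyMeasurable C (ae_of_all _ hξC)

lemma abs_covariance_le_of_superlevel [IsProbabilityMeasure μ] (hξ : Measurable ξ)
    (hη : Measurable η) (hξC : ∀ ω, |ξ ω| ≤ C) (hηD : ∀ ω, |η ω| ≤ D)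
    (h : ∀ s t, |μ.real ({ω | s ≤ ξ ω} ∩ {ω | t ≤ η ω})
      - μ.real {ω | s ≤ ξ ω} * μ.real {ω | t ≤ η ω}| ≤ a) :
    |cov[ξ, η; μ]| ≤ 4 * C * D * a := by
  obtain ⟨ω₀⟩ := nonempty_of_isProbabilityMeasure μ
  have hC : 0 ≤ C := (abs_nonneg _).trans (hξC ω₀)
  have hD : 0 ≤ D := (abs_nonneg _).trans (hηD ω₀)
  have hshift {ζ : Ω → ℝ} {c : ℝ} (hζ : ∀ ω, |ζ ω| ≤ c) (ω : Ω) :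
      ζ ω + c ∈ Set.Icc 0 (2 * c) := by
    have := abs_le.1 (hζ ω)
    constructor <;> linarith
  have hξL : MemLp ξ 2 μ := memLp_of_abs_le hξ hξC 2
  have hηL : MemLp η 2 μ := memLp_of_abs_le hη hηD 2
  rw [← covariance_add_const_left (hξL.integrable one_le_two) C,
    ← covariance_add_const_right (hηL.integrable one_le_two) D,
    covariance_eq_sub (X := fun ω => ξ ω + C) (Y := fun ω => η ω + D)
      (hξL.add (memLp_const C)) (hηL.add (memLp_const D))]
  calc _ ≤ 2 * D * (2 * C * a) :=
        abs_integral_mul_sub_le_of_superlevel (by positivity) (by positivity) (hξ.add_const C)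
          (hη.add_const D) (hshift hξC) (hshift hηD) fun s t => by
            simpa only [sub_le_iff_le_add] using h (s - C) (t - D)
    _ = 4 * C * D * a := by ring

lemma abs_integral_le_of_support [IsFiniteMeasure μ] {A : Set Ω} (hξC : ∀ ω, |ξ ω| ≤ C)
    (hξA : ∀ ω ∉ A, ξ ω = 0) : |∫ ω, ξ ω ∂μ| ≤ C * μ.real A := by
  rw [← setIntegral_eq_integral_of_forall_compl_eq_zero hξA, ← Real.norm_eq_abs]
  exact norm_setIntegral_le_of_norm_le_const (measure_lt_top _ _) fun ω _ => hξC ω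

lemma abs_covariance_le_of_support [IsProbabilityMeasure μ] (hξ : Measurable ξ)
    (hη : Measurable η) (hξC : ∀ ω, |ξ ω| ≤ C) (hηD : ∀ ω, |η ω| ≤ D) {A B : Set Ω}
    (hξA : ∀ ω ∉ A, ξ ω = 0) (hηB : ∀ ω ∉ B, η ω = 0) :
    |cov[ξ, η; μ]| ≤ C * D * (μ.real (A ∩ B) + μ.real A * μ.real B) := by
  obtain ⟨ω₀⟩ := nonempty_of_isProbabilityMeasure μ
  have hC : 0 ≤ C := (abs_nonneg _).trans (hξC ω₀)
  have hprod : |∫ ω, ξ ω * η ω ∂μ| ≤ C * D * μ.real (A ∩ B) := by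
    refine abs_integral_le_of_support (fun ω => ?_) fun ω hω => mul_eq_zero.2 ?_
    · rw [abs_mul]
      exact mul_le_mul (hξC ω) (hηD ω) (abs_nonneg _) hC
    · exact (not_and_or.1 hω).imp (hξA ω) (hηB ω)
  have hmeans : |(∫ ω, ξ ω ∂μ) * ∫ ω, η ω ∂μ| ≤ C * μ.real A * (D * μ.real B) := by
    rw [abs_mul]
    exact mul_le_mul (abs_integral_le_of_support hξC hξA) (abs_integral_le_of_support hηD hηB)
      (abs_nonneg _) (by positivity)
  rw [covariance_eq_sub (memLp_of_abs_le hξ hξC 2) (memLp_of_abs_le hη hηD 2)]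
  calc _ ≤ |∫ ω, ξ ω * η ω ∂μ| + |(∫ ω, ξ ω ∂μ) * ∫ ω, η ω ∂μ| := abs_sub _ _
    _ ≤ C * D * μ.real (A ∩ B) + C * μ.real A * (D * μ.real B) := add_le_add hprod hmeans
    _ = _ := by ring

lemma variance_sum_le_of_covariance_lag_le [IsFiniteMeasure μ] {ξ : ℕ → Ω → ℝ}
    (hξ : ∀ i, MemLp (ξ i) 2 μ) {b : ℕ → ℝ} (hb : Summable b) (hb0 : ∀ k, 0 ≤ b k)
    (hcov : ∀ i k, cov[ξ i, ξ (i + k); μ] ≤ b k) (n : ℕ) :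
    Var[fun ω => ∑ i : Fin n, ξ i ω; μ] ≤ n * (2 * ∑' k, b k) := by
  set c : Fin n → Fin n → ℝ := fun i j => if i ≤ j then b (j - i) else 0 with hc
  have hc0 (i j : Fin n) : 0 ≤ c i j := by
    simp only [hc]
    split_ifs
    exacts [hb0 _, le_rfl]
  have hle {i j : Fin n} (hij : i ≤ j) : cov[ξ i, ξ j; μ] ≤ c i j := by
    have := hcov i (j - i)
    rwa [Nat.add_sub_cancel' (Fin.val_fin_le.2 hij),
      ← show c i j = b (j - i) from if_pos hij] at this
  have hrow (i : Fin n) : ∑ j, c i j ≤ ∑' k, b k := by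
    have hinj : Set.InjOn (fun j : Fin n => (j : ℕ) - i) (Finset.univ.filter (i ≤ ·)) := by
      intro j hj k hk hjk
      simp only [Finset.coe_filter, Finset.mem_univ, true_and, Set.mem_ofPred_eq] at hj hk
      have : (j : ℕ) - i = k - i := hjk
      omega
    simp only [hc]
    rw [← Finset.sum_filter, ← Finset.sum_image (f := b) hinj]
    exact hb.sum_le_tsum _ fun k _ => hb0 k
  calc Var[fun ω => ∑ i : Fin n, ξ i ω; μ]
      = ∑ i : Fin n, ∑ j : Fin n, cov[ξ i, ξ j; μ] := variance_fun_sum fun i : Fin n => hξ i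
    _ ≤ ∑ i, ∑ j, (c i j + c j i) := by
        gcongr with i _ j _
        rcases le_total i j with hij | hji
        · exact (hle hij).trans (le_add_of_nonneg_right (hc0 j i))
        · rw [covariance_comm]
          exact (hle hji).trans (le_add_of_nonneg_left (hc0 i j))
    _ = 2 * ∑ i, ∑ j, c i j := by
        simp only [Finset.sum_add_distrib]
        rw [Finset.sum_comm (f := fun i j => c j i), two_mul]
    _ ≤ 2 * ∑ _i : Fin n, ∑' k, b k := by
        gcongr with i
        exact hrow i
    _ = n * (2 * ∑' k, b k) := by
        rw [Finset.sum_const, Finset.card_univ, Fintype.card_fin, nsmul_eq_mul]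
        ring

end Covariance

section SigmaAlgebras

variable {Ω S : Type*} [MeasurableSpace S] {V : ℕ → Ω → S} {m i : ℕ} {s : Set S}

lemma measurableSet_pastSigma_preimage (hi : i ≤ m) (hs : MeasurableSet s) :
    MeasurableSet[pastSigma V m] (V i ⁻¹' s) :=
  le_iSup₂_of_le (f := fun i (_ : i ≤ m) => MeasurableSpace.comap (V i) inferInstance) i hi le_rfl
    _ ⟨s, hs, rfl⟩

lemma measurableSet_futureSigma_preimage (hi : m ≤ i) (hs : MeasurableSet s) :
    MeasurableSet[futureSigma V m] (V i ⁻¹' s) :=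
  le_iSup₂_of_le (f := fun i (_ : m ≤ i) => MeasurableSpace.comap (V i) inferInstance) i hi le_rfl
    _ ⟨s, hs, rfl⟩

end SigmaAlgebras

section Mixing

variable {Ω S : Type*} [MeasurableSpace Ω] [MeasurableSpace S] {μ : Measure Ω} {V : ℕ → Ω → S}

lemma abs_measureReal_inter_sub_mul_le_one [IsProbabilityMeasure μ] (A B : Set Ω) :
    |μ.real (A ∩ B) - μ.real A * μ.real B| ≤ 1 :=
  abs_sub_le_of_nonneg_of_le measureReal_nonneg measureReal_le_one (by positivity)
    (mul_le_one₀ measureReal_le_one measureReal_nonneg measureReal_le_one)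

lemma le_mixingCoeff [IsProbabilityMeasure μ] {m τ : ℕ} {A B : Set Ω}
    (hA : MeasurableSet[pastSigma V m] A) (hB : MeasurableSet[futureSigma V (m + τ)] B) :
    |μ.real (A ∩ B) - μ.real A * μ.real B| ≤ mixingCoeff V μ τ := by
  refine le_csSup ⟨1, ?_⟩ ⟨m, A, B, hA, hB, rfl⟩
  rintro r ⟨m, A, B, -, -, rfl⟩
  exact abs_measureReal_inter_sub_mul_le_one A B

lemma mixingCoeff_nonneg (τ : ℕ) : 0 ≤ mixingCoeff V μ τ := by
  refine Real.sSup_nonneg ?_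
  rintro r ⟨m, A, B, -, -, rfl⟩
  exact abs_nonneg _

lemma abs_covariance_le_mixingCoeff [IsProbabilityMeasure μ] (hV : ∀ i, Measurable (V i))
    {f : S → ℝ} (hf : Measurable f) {C : ℝ} (hC : ∀ s, |f s| ≤ C) (i k : ℕ) :
    |cov[fun ω => f (V i ω), fun ω => f (V (i + k) ω); μ]| ≤ 4 * C * C * mixingCoeff V μ k :=
  abs_covariance_le_of_superlevel (hf.comp (hV i)) (hf.comp (hV (i + k))) (fun _ => hC _)
    (fun _ => hC _) fun _ _ => le_mixingCoeff (m := i)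
      (measurableSet_pastSigma_preimage le_rfl (measurableSet_le measurable_const hf))
      (measurableSet_futureSigma_preimage le_rfl (measurableSet_le measurable_const hf))

lemma IsStationary.map_pair (hstat : IsStationary V μ) (hV : ∀ i, Measurable (V i)) (i j k : ℕ) :
    μ.map (fun ω => (V (i + k) ω, V (j + k) ω)) = μ.map fun ω => (V i ω, V j ω) := by
  have hproj : Measurable fun v : ℕ → S => (v i, v j) := by fun_prop
  have h := congrArg (Measure.map fun v : ℕ → S => (v i, v j)) (hstat k)
  rwa [Measure.map_map hproj (by fun_prop), Measure.map_map hproj (by fun_prop)] at h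

lemma IsStationary.map_eq (hstat : IsStationary V μ) (hV : ∀ i, Measurable (V i)) (i : ℕ) :
    μ.map (V i) = μ.map (V 0) := by
  have h := congrArg (Measure.map Prod.fst) (hstat.map_pair hV 0 0 i)
  rw [Measure.map_map measurable_fst (by fun_prop),
    Measure.map_map measurable_fst (by fun_prop)] at h
  simpa only [Function.comp_def, zero_add] using h

lemma IsStationary.integral_eq (hstat : IsStationary V μ) (hV : ∀ i, Measurable (V i)) {f : S → ℝ}
    (hf : Measurable f) (i : ℕ) : ∫ ω, f (V i ω) ∂μ = ∫ ω, f (V 0 ω) ∂μ := by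
  rw [← integral_map (hV i).aemeasurable hf.aestronglyMeasurable, hstat.map_eq hV,
    integral_map (hV 0).aemeasurable hf.aestronglyMeasurable]

lemma IsStationary.covariance_eq (hstat : IsStationary V μ) (hV : ∀ i, Measurable (V i))
    {f : S → ℝ} (hf : Measurable f) (i k : ℕ) :
    cov[fun ω => f (V i ω), fun ω => f (V (i + k) ω); μ]
      = cov[fun ω => f (V 0 ω), fun ω => f (V k ω); μ] := by
  have hcov (a b : ℕ) : cov[fun ω => f (V a ω), fun ω => f (V b ω); μ]
      = cov[fun v => f v.1, fun v => f v.2; μ.map fun ω => (V a ω, V b ω)] :=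
    (covariance_map_fun (hf.comp measurable_fst).aestronglyMeasurable
      (hf.comp measurable_snd).aestronglyMeasurable ((hV a).prodMk (hV b)).aemeasurable).symm
  rw [hcov, hcov, ← hstat.map_pair hV 0 k i, zero_add, add_comm k]

lemma MixingAssumption.summable_sqrt_mixingCoeff {δ : ℝ} (hδ : 0 < δ)
    (hmix : MixingAssumption V μ δ) : Summable fun k => √(mixingCoeff V μ k) := by
  have hsqrt : (fun k => √(mixingCoeff V μ k)) =O[atTop] fun k : ℕ => √((k : ℝ) ^ (-(2 + δ))) :=
    hmix.mixing.sqrt (.of_forall fun k => by positivity)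
  refine summable_of_isBigO_nat (Real.summable_nat_rpow.2 (?_ : -(2 + δ) / 2 < -1)) ?_
  · linarith
  · refine hsqrt.congr_right fun k => ?_
    rw [Real.sqrt_eq_rpow, ← Real.rpow_mul k.cast_nonneg, mul_one_div]

end Mixing

section RareEvents

/-- A bound for the covariance, at lag `k` and per unit of probability, of two bounded variables
carried by rare events: events at lags below `i₀` may coincide, while beyond `i₀`
near-independence and mixing are combined through their geometric mean. -/
noncomputable def lagBound (α : ℕ → ℝ) (i₀ k : ℕ) : ℝ :=
  2 * (if k < i₀ then 1 else 0) + 3 * √(α k)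

lemma lagBound_nonneg (α : ℕ → ℝ) (i₀ k : ℕ) : 0 ≤ lagBound α i₀ k := by
  unfold lagBound
  split_ifs <;> positivity

lemma summable_lagBound {α : ℕ → ℝ} (hα : Summable fun k => √(α k)) (i₀ : ℕ) :
    Summable (lagBound α i₀) := by
  refine .add (.mul_left _ (summable_of_ne_finset_zero (s := Finset.range i₀) fun k hk => ?_))
    (hα.mul_left _)
  exact if_neg (Finset.mem_range.not.1 hk)

variable {Ω S : Type*} [MeasurableSpace Ω] [MeasurableSpace S] {μ : Measure Ω}
  [IsProbabilityMeasure μ] {V : ℕ → Ω → S}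

lemma abs_covariance_le_of_rare (hV : ∀ i, Measurable (V i)) {f : S → ℝ} (hf : Measurable f)
    {C : ℝ} (hC : ∀ s, |f s| ≤ C) {A : Set S} (hfA : ∀ s ∉ A, f s = 0) {q : ℝ}
    (hq : ∀ k, μ.real (V k ⁻¹' A) ≤ q) {i₀ : ℕ}
    (hq₂ : ∀ k ≥ i₀, μ.real (V 0 ⁻¹' A ∩ V k ⁻¹' A) ≤ q ^ 2) (k : ℕ) :
    |cov[fun ω => f (V 0 ω), fun ω => f (V k ω); μ]|
      ≤ C ^ 2 * q * lagBound (mixingCoeff V μ) i₀ k := by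
  set c := |cov[fun ω => f (V 0 ω), fun ω => f (V k ω); μ]|
  have hq0 : 0 ≤ q := measureReal_nonneg.trans (hq 0)
  have hsupport : c ≤ C * C * (μ.real (V 0 ⁻¹' A ∩ V k ⁻¹' A)
      + μ.real (V 0 ⁻¹' A) * μ.real (V k ⁻¹' A)) :=
    abs_covariance_le_of_support (hf.comp (hV 0)) (hf.comp (hV k)) (fun _ => hC _)
      (fun _ => hC _) (fun _ hω => hfA _ hω) fun _ hω => hfA _ hω
  have hCC : 0 ≤ C * C := mul_self_nonneg C
  unfold lagBound
  split_ifs with hk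
  · have hinter : μ.real (V 0 ⁻¹' A ∩ V k ⁻¹' A) ≤ q :=
      (measureReal_mono Set.inter_subset_left).trans (hq 0)
    have hprod : μ.real (V 0 ⁻¹' A) * μ.real (V k ⁻¹' A) ≤ q :=
      (mul_le_of_le_one_right measureReal_nonneg measureReal_le_one).trans (hq 0)
    calc c ≤ C * C * (q + q) := hsupport.trans (by gcongr)
      _ = C ^ 2 * q * (2 * 1) := by ring
      _ ≤ _ := by gcongr; exact le_add_of_nonneg_right (by positivity)
  · have hindep : c ≤ C * C * (q ^ 2 + q * q) :=
      hsupport.trans (by gcongr; exacts [hq₂ k (not_lt.1 hk), hq 0, hq k])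
    have hmixing : c ≤ 4 * C * C * mixingCoeff V μ k := by
      simpa only [zero_add] using abs_covariance_le_mixingCoeff hV hf hC 0 k
    rw [mul_zero, zero_add]
    refine le_of_sq_le_sq ?_ (by positivity)
    calc c ^ 2 = c * c := sq c
      _ ≤ C * C * (q ^ 2 + q * q) * (4 * C * C * mixingCoeff V μ k) :=
          mul_le_mul hindep hmixing (abs_nonneg _) (by positivity)
      _ = 8 * (C ^ 2 * q) ^ 2 * mixingCoeff V μ k := by ring
      _ ≤ 9 * (C ^ 2 * q) ^ 2 * mixingCoeff V μ k := by
          gcongr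
          exacts [mixingCoeff_nonneg k, by norm_num]
      _ = (C ^ 2 * q * (3 * √(mixingCoeff V μ k))) ^ 2 := by
          rw [mul_pow _ (3 * _), mul_pow 3, Real.sq_sqrt (mixingCoeff_nonneg k)]
          ring

lemma variance_sum_le_of_rare (hV : ∀ i, Measurable (V i)) (hstat : IsStationary V μ)
    (hmix : Summable fun k => √(mixingCoeff V μ k)) {f : S → ℝ} (hf : Measurable f) {C : ℝ}
    (hC : ∀ s, |f s| ≤ C) {A : Set S} (hA : MeasurableSet A) (hfA : ∀ s ∉ A, f s = 0) {q : ℝ}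
    (hq : μ.real (V 0 ⁻¹' A) ≤ q) {i₀ : ℕ}
    (hq₂ : ∀ k ≥ i₀, μ.real (V 0 ⁻¹' A ∩ V k ⁻¹' A) ≤ q ^ 2) (n : ℕ) :
    Var[fun ω => ∑ i : Fin n, f (V i ω); μ]
      ≤ n * (q * (2 * C ^ 2 * ∑' k, lagBound (mixingCoeff V μ) i₀ k)) := by
  have hq0 : 0 ≤ q := measureReal_nonneg.trans hq
  have hqk (k : ℕ) : μ.real (V k ⁻¹' A) ≤ q := by
    rwa [← map_measureReal_apply (hV k) hA, hstat.map_eq hV, map_measureReal_apply (hV 0) hA]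
  have hcov (i k : ℕ) : cov[fun ω => f (V i ω), fun ω => f (V (i + k) ω); μ]
      ≤ C ^ 2 * q * lagBound (mixingCoeff V μ) i₀ k := by
    rw [hstat.covariance_eq hV hf]
    exact (le_abs_self _).trans (abs_covariance_le_of_rare hV hf hC hfA hqk hq₂ k)
  calc Var[fun ω => ∑ i : Fin n, f (V i ω); μ]
      ≤ n * (2 * ∑' k, C ^ 2 * q * lagBound (mixingCoeff V μ) i₀ k) :=
        variance_sum_le_of_covariance_lag_le
          (fun i => memLp_of_abs_le (hf.comp (hV i)) (fun _ => hC _) 2)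
          ((summable_lagBound hmix i₀).mul_left _)
          (fun k => mul_nonneg (by positivity) (lagBound_nonneg _ _ k)) hcov n
    _ = n * (q * (2 * C ^ 2 * ∑' k, lagBound (mixingCoeff V μ) i₀ k)) := by
        rw [tsum_mul_left]
        ring

theorem tendsto_average_of_rare (hV : ∀ i, Measurable (V i)) (hstat : IsStationary V μ)
    (hmix : Summable fun k => √(mixingCoeff V μ k)) {f : ℕ → S → ℝ} {A : ℕ → Set S} {p : ℕ → ℝ}
    {C D L : ℝ} {i₀ : ℕ} (hf : ∀ n, Measurable (f n)) (hC : ∀ n s, |f n s| ≤ C)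
    (hA : ∀ n, MeasurableSet (A n)) (hfA : ∀ᶠ n in atTop, ∀ s ∉ A n, f n s = 0)
    (hp : Tendsto (fun n : ℕ => n * p n) atTop atTop)
    (hA₁ : ∀ᶠ n in atTop, μ.real (V 0 ⁻¹' A n) ≤ D * p n)
    (hA₂ : ∀ᶠ n in atTop, ∀ k ≥ i₀, μ.real (V 0 ⁻¹' A n ∩ V k ⁻¹' A n) ≤ (D * p n) ^ 2)
    (hmean : Tendsto (fun n => (p n)⁻¹ * ∫ ω, f n (V 0 ω) ∂μ) atTop (𝓝 L)) :
    Tendsto (fun z : ℕ × Ω => (z.1 * p z.1)⁻¹ * ∑ i : Fin z.1, f z.1 (V i z.2))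
      (highProbability μ atTop) (𝓝 L) := by
  set B := 2 * C ^ 2 * ∑' k, lagBound (mixingCoeff V μ) i₀ k
  have hL (n i : ℕ) : MemLp (fun ω => f n (V i ω)) 2 μ :=
    memLp_of_abs_le ((hf n).comp (hV i)) (fun _ => hC n _) 2
  have hpos : ∀ᶠ n : ℕ in atTop, 0 < n * p n := hp.eventually_gt_atTop 0
  refine tendsto_highProbability_of_variance (Z := fun n ω => (n * p n)⁻¹ *
    ∑ i : Fin n, f n (V i ω)) (fun n => ?_) (hmean.congr' ?_) ?_
  · exact (memLp_finsetSum (Finset.univ : Finset (Fin n)) fun i _ => hL n i).const_mul _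
  · filter_upwards [hpos] with n hn
    rw [integral_const_mul, integral_finsetSum (Finset.univ : Finset (Fin n)) fun i _ =>
      (hL n i).integrable one_le_two]
    simp only [hstat.integral_eq hV (hf n), Finset.sum_const, Finset.card_univ, Fintype.card_fin,
      nsmul_eq_mul]
    have := left_ne_zero_of_mul hn.ne'
    field_simp
  · have hbound : Tendsto (fun n : ℕ => D * B * (n * p n)⁻¹) atTop (𝓝 0) := by
      simpa using hp.inv_tendsto_atTop.const_mul (D * B)
    refine tendsto_of_tendsto_of_tendsto_of_le_of_le' tendsto_const_nhds hbound
      (.of_forall fun n => variance_nonneg _ _) ?_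
    filter_upwards [hpos, hfA, hA₁, hA₂] with n hn h₀ h₁ h₂
    calc Var[fun ω => (n * p n)⁻¹ * ∑ i : Fin n, f n (V i ω); μ]
        ≤ ((n * p n)⁻¹) ^ 2 * (n * (D * p n * B)) := by
          rw [variance_const_mul]
          gcongr
          exact variance_sum_le_of_rare hV hstat hmix (hf n) (hC n) (hA n) h₀ h₁ h₂ n
      _ = D * B * (n * p n)⁻¹ := by
          have := left_ne_zero_of_mul hn.ne'
          have := right_ne_zero_of_mul hn.ne'
          field_simp

end RareEvents

section LocalDensity

variable {Ω E : Type*} [MeasurableSpace Ω] {μ : Measure Ω} {g : E → ℝ} {x : E}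

lemma IsDensity.real_le [MeasureSpace E] {ν : Measure E} (hg : IsDensity ν g) {B : Set E}
    (hB : MeasurableSet B) (hfin : volume B ≠ ∞) {c : ℝ} (hc : 0 ≤ c) (hle : ∀ u ∈ B, g u ≤ c) :
    ν.real B ≤ c * volume.real B := by
  have hmeas : ν B ≤ ENNReal.ofReal c * volume B := by
    rw [hg.eq_withDensity, withDensity_apply _ hB, ← setLIntegral_const]
    exact setLIntegral_mono measurable_const fun u hu => ENNReal.ofReal_le_ofReal (hle u hu)
  have hreal := ENNReal.toReal_mono (ENNReal.mul_ne_top ENNReal.ofReal_ne_top hfin) hmeas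
  rwa [ENNReal.toReal_mul, ENNReal.toReal_ofReal hc] at hreal

lemma IsDensity.integral_eq [MeasureSpace E] {ν : Measure E} (hg : IsDensity ν g) (f : E → ℝ) :
    ∫ u, f u ∂ν = ∫ u, f u * g u := by
  rw [hg.eq_withDensity, integral_withDensity_eq_integral_toReal_smul
    hg.measurable.ennreal_ofReal (ae_of_all _ fun _ => ENNReal.ofReal_lt_top)]
  simp only [ENNReal.toReal_ofReal (hg.nonneg _), smul_eq_mul, mul_comm]

/-- Local regularity at `x` of the one- and two-point laws of the process `X`: the density `g` of
`X 0` is continuous at `x`, and the pairs `(X 0, X i)` have, for all large `i`, densities that are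
bounded near `(x, x)` uniformly in `i`. -/
structure HasLocalDensities [TopologicalSpace E] [MeasureSpace E] (μ : Measure Ω)
    (X : ℕ → Ω → E) (g : E → ℝ) (x : E) : Prop where
  density : IsDensity (μ.map (X 0)) g
  continuousAt : ContinuousAt g x
  joint_density : ∃ M : ℝ, ∃ U ∈ 𝓝 x, ∀ᶠ i in atTop, ∃ g₂ : E × E → ℝ,
    IsDensity (μ.map fun ω => (X 0 ω, X i ω)) g₂ ∧ ∀ u ∈ U, ∀ v ∈ U, g₂ (u, v) ≤ M

variable [NormedAddCommGroup E]

lemma eventually_closedBall_mul_subset {U : Set E} (hU : U ∈ 𝓝 x) (R : ℝ) :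
    ∀ᶠ h in 𝓝[>] (0 : ℝ), Metric.closedBall x (h * R) ⊆ U := by
  obtain ⟨r, hr, hrU⟩ := Metric.nhds_basis_closedBall.mem_iff.1 hU
  have hshrink : Tendsto (fun h : ℝ => h * R) (𝓝[>] 0) (𝓝 0) := by
    simpa using ((continuous_mul_const R).tendsto 0).mono_left nhdsWithin_le_nhds
  filter_upwards [hshrink.eventually_le_const hr] with h hh
  exact (Metric.closedBall_subset_closedBall hh).trans hrU

variable [NormedSpace ℝ E] [FiniteDimensional ℝ E] [MeasureSpace E] [BorelSpace E]
  [(volume : Measure E).IsAddHaarMeasure]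

lemma HasLocalDensities.exists_real_closedBall_le {X : ℕ → Ω → E} (hX : ∀ i, Measurable (X i))
    (hd : HasLocalDensities μ X g x) {R : ℝ} (hR : 0 ≤ R) :
    ∃ D : ℝ, ∃ i₀ : ℕ, ∀ᶠ h in 𝓝[>] (0 : ℝ),
      μ.real (X 0 ⁻¹' Metric.closedBall x (h * R)) ≤ D * h ^ Module.finrank ℝ E ∧
      ∀ i ≥ i₀, μ.real (X 0 ⁻¹' Metric.closedBall x (h * R)
        ∩ X i ⁻¹' Metric.closedBall x (h * R)) ≤ (D * h ^ Module.finrank ℝ E) ^ 2 := by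
  obtain ⟨M, U, hU, hM⟩ := hd.joint_density
  obtain ⟨i₀, hi₀⟩ := eventually_atTop.1 hM
  have hgx : 0 ≤ g x := hd.density.nonneg x
  set c := g x + 1 + |M|
  have hc : 1 ≤ c := by linarith [abs_nonneg M]
  have hMc : M ≤ c ^ 2 := by nlinarith [le_abs_self M]
  refine ⟨c * (R ^ Module.finrank ℝ E * volume.real (Metric.ball (0 : E) 1)), i₀, ?_⟩
  filter_upwards [self_mem_nhdsWithin, eventually_closedBall_mul_subset hU R,
    eventually_closedBall_mul_subset (hd.continuousAt.eventually_le_const (lt_add_one (g x))) R]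
    with h (hh : 0 < h) hBU hBg
  set B := Metric.closedBall x (h * R) with hB
  have hBm : MeasurableSet B := Metric.isClosed_closedBall.measurableSet
  have hBfin : volume B ≠ ∞ := (isCompact_closedBall x _).measure_ne_top
  have hvol : c * (R ^ Module.finrank ℝ E * volume.real (Metric.ball (0 : E) 1))
      * h ^ Module.finrank ℝ E = c * volume.real B := by
    rw [hB, Measure.addHaar_real_closedBall _ _ (by positivity), mul_pow]
    ring
  rw [hvol]
  refine ⟨?_, fun i hi => ?_⟩
  · rw [← map_measureReal_apply (hX 0) hBm]
    refine hd.density.real_le hBm hBfin (by positivity) fun u hu => ?_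
    exact (hBg hu).trans (le_add_of_nonneg_right (abs_nonneg M))
  · obtain ⟨g₂, hg₂, hg₂M⟩ := hi₀ i hi
    have hpair : μ.real (X 0 ⁻¹' B ∩ X i ⁻¹' B)
        = (μ.map fun ω => (X 0 ω, X i ω)).real (B ×ˢ B) :=
      (map_measureReal_apply ((hX 0).prodMk (hX i)) (hBm.prod hBm)).symm
    have hprod : volume.real (B ×ˢ B) = volume.real B * volume.real B := measureReal_prod_prod B B
    rw [hpair, mul_pow, sq (volume.real B), ← hprod]
    refine hg₂.real_le (hBm.prod hBm) ?_ (by positivity) fun u hu => ?_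
    · rw [Measure.volume_eq_prod, Measure.prod_prod]
      exact ENNReal.mul_ne_top hBfin hBfin
    · exact (hg₂M _ (hBU hu.1) _ (hBU hu.2)).trans hMc

end LocalDensity

section LocalIntegral

variable {E : Type*} [NormedAddCommGroup E] [NormedSpace ℝ E] [MeasureSpace E] [BorelSpace E]

lemma tendsto_integral_mul_comp_add_smul [IsFiniteMeasureOnCompacts (volume : Measure E)]
    {φ m : E → ℝ} {x : E} (hm : Measurable m) (hmx : ContinuousAt m x) (hφ : Measurable φ) {C : ℝ}
    (hC : ∀ u, |φ u| ≤ C) (hsupp : HasCompactSupport φ) :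
    Tendsto (fun h : ℝ => ∫ u, φ u * m (x + h • u)) (𝓝[>] 0) (𝓝 ((∫ u, φ u) * m x)) := by
  have hC0 : 0 ≤ C := (abs_nonneg _).trans (hC 0)
  obtain ⟨R, hR⟩ := hsupp.isCompact.isBounded.subset_closedBall 0
  rw [← integral_mul_const]
  refine tendsto_integral_filter_of_dominated_convergence
    ((tsupport φ).indicator fun _ => C * (|m x| + 1)) (.of_forall fun h => ?_) ?_ ?_
    (ae_of_all _ fun u => .const_mul _ ?_)
  · exact (hφ.mul (hm.comp (by fun_prop))).aestronglyMeasurable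
  · have hnear : ∀ᶠ v in 𝓝 x, |m v| ≤ |m x| + 1 :=
      hmx.abs.eventually_le_const (lt_add_one _)
    filter_upwards [eventually_closedBall_mul_subset hnear R, self_mem_nhdsWithin]
      with h hball (hh : 0 < h)
    refine ae_of_all _ fun u => ?_
    by_cases hu : u ∈ tsupport φ
    · rw [Set.indicator_of_mem hu, norm_mul]
      refine mul_le_mul (hC u) (hball ?_) (norm_nonneg _) hC0
      rw [mem_closedBall_iff_norm, add_sub_cancel_left, norm_smul, Real.norm_of_nonneg hh.le]
      exact mul_le_mul_of_nonneg_left (mem_closedBall_zero_iff.1 (hR hu)) hh.le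
    · rw [Set.indicator_of_notMem hu, image_eq_zero_of_notMem_tsupport hu, zero_mul, norm_zero]
  · exact (integrable_indicator_iff (isClosed_tsupport φ).measurableSet).2
      (integrableOn_const hsupp.isCompact.measure_ne_top)
  · have hline : Tendsto (fun h : ℝ => x + h • u) (𝓝[>] 0) (𝓝 x) := by
      have : Continuous fun h : ℝ => x + h • u := by fun_prop
      simpa using (this.tendsto 0).mono_left nhdsWithin_le_nhds
    exact hmx.tendsto.comp hline

lemma integral_comp_rescale_mul [FiniteDimensional ℝ E]
    [(volume : Measure E).IsAddHaarMeasure] (φ m : E → ℝ) (x : E) {h : ℝ} (hh : 0 < h) :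
    ∫ v, φ (h⁻¹ • (v - x)) * m v = h ^ Module.finrank ℝ E * ∫ u, φ u * m (x + h • u) := by
  have hscale := Measure.integral_comp_inv_smul volume (fun u => φ u * m (x + h • u)) h
  rw [abs_of_pos (by positivity), smul_eq_mul] at hscale
  rw [← hscale, ← integral_sub_right_eq_self (fun v => φ (h⁻¹ • v) * m (x + h • h⁻¹ • v)) x]
  simp only [smul_inv_smul₀ hh.ne', add_sub_cancel]

end LocalIntegral

section CondDistrib

variable {Ω E T : Type*} [MeasurableSpace Ω] [MeasurableSpace E] [MeasurableSpace T]
  {μ : Measure Ω} [IsFiniteMeasure μ] {X : Ω → E} {Y : Ω → T} {κ : Kernel E T} [IsMarkovKernel κ]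

lemma integral_mul_eq_integral_condDistrib (hX : Measurable X) (hY : Measurable Y)
    (hκ : HasCondDistrib Y X κ μ) {ψ : T → ℝ} (hψ : Measurable ψ) {D : ℝ} (hD : ∀ y, |ψ y| ≤ D)
    {φ : E → ℝ} (hφ : Measurable φ) {C : ℝ} (hC : ∀ u, |φ u| ≤ C) :
    ∫ ω, ψ (Y ω) * φ (X ω) ∂μ = ∫ u, φ u * ∫ y, ψ y ∂κ u ∂μ.map X := by
  have hf : Measurable fun v : E × T => ψ v.2 * φ v.1 := by fun_prop
  have hbound (v : E × T) : ‖ψ v.2 * φ v.1‖ ≤ D * C := by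
    rw [norm_mul]
    exact mul_le_mul (hD _) (hC _) (norm_nonneg _) ((abs_nonneg _).trans (hD v.2))
  calc ∫ ω, ψ (Y ω) * φ (X ω) ∂μ = ∫ v, ψ v.2 * φ v.1 ∂(μ.map X ⊗ₘ κ) := by
        rw [← (show HasLaw _ _ μ from hκ).map_eq,
          integral_map (hX.prodMk hY).aemeasurable hf.aestronglyMeasurable]
    _ = ∫ u, φ u * ∫ y, ψ y ∂κ u ∂μ.map X := by
        rw [Measure.integral_compProd (Integrable.of_bound hf.aestronglyMeasurable (D * C)
          (ae_of_all _ hbound))]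
        simp only [integral_mul_const, mul_comm]

end CondDistrib

section LocalAverage

/-- The average of `ψ (Y i) • φ` over the observations, with `φ` localized at `x` in a window of
size `h` and normalized by the volume scale of the window. -/
noncomputable def localAverage {E F T : Type*} [AddCommGroup E] [Module ℝ E] [AddCommGroup F]
    [Module ℝ F] {n : ℕ} (φ : E → F) (ψ : T → ℝ) (x : E) (h : ℝ) (X : Fin n → E)
    (Y : Fin n → T) : F :=
  (n * h ^ Module.finrank ℝ E)⁻¹ • ∑ i, ψ (Y i) • φ (h⁻¹ • (X i - x))

/-- A stationary mixing sequence of predictors `X` and responses `Y`, where `κ` is the conditional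
law of the response, whose predictors have well-behaved densities near the point `x`. -/
structure LocallyRegularSample {Ω E T : Type*} [MeasurableSpace Ω] [TopologicalSpace E]
    [MeasureSpace E] [MeasurableSpace T] (μ : Measure Ω) (X : ℕ → Ω → E) (Y : ℕ → Ω → T)
    (κ : Kernel E T) (g : E → ℝ) (x : E) : Prop where
  measurable_predictor : ∀ i, Measurable (X i)
  measurable_response : ∀ i, Measurable (Y i)
  stationary : IsStationary (fun i ω => (X i ω, Y i ω)) μ
  summable_sqrt_mixingCoeff : Summable fun τ => √(mixingCoeff (fun i ω => (X i ω, Y i ω)) μ τ)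
  condDistrib : HasCondDistrib (Y 0) (X 0) κ μ
  densities : HasLocalDensities μ X g x

variable {Ω E F T : Type*} [MeasurableSpace Ω] [NormedAddCommGroup E] [NormedSpace ℝ E]
  [FiniteDimensional ℝ E] [MeasureSpace E] [BorelSpace E]
  [(volume : Measure E).IsAddHaarMeasure] [MeasurableSpace T] {μ : Measure Ω}
  [IsProbabilityMeasure μ] {X : ℕ → Ω → E} {Y : ℕ → Ω → T} {κ : Kernel E T} [IsMarkovKernel κ]
  {g : E → ℝ} {x : E} {h : ℕ → ℝ} {ψ : T → ℝ} {D : ℝ}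

lemma LocallyRegularSample.tendsto_integral_localized (hS : LocallyRegularSample μ X Y κ g x)
    {φ : E → ℝ} (hφ : Measurable φ) {C : ℝ} (hC : ∀ u, |φ u| ≤ C) (hsupp : HasCompactSupport φ)
    (hψ : Measurable ψ) (hD : ∀ y, |ψ y| ≤ D) (hψx : ContinuousAt (fun u => ∫ y, ψ y ∂κ u) x) :
    Tendsto (fun h : ℝ => (h ^ Module.finrank ℝ E)⁻¹
      * ∫ ω, ψ (Y 0 ω) * φ (h⁻¹ • (X 0 ω - x)) ∂μ) (𝓝[>] 0)
      (𝓝 ((∫ y, ψ y ∂κ x) * g x * ∫ u, φ u)) := by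
  set m : E → ℝ := fun u => (∫ y, ψ y ∂κ u) * g u
  have hm : Measurable m :=
    hψ.stronglyMeasurable.integral_kernel.measurable.mul hS.densities.density.measurable
  rw [mul_comm (_ * _)]
  refine (tendsto_integral_mul_comp_add_smul hm (hψx.mul hS.densities.continuousAt) hφ hC
    hsupp).congr' ?_
  filter_upwards [self_mem_nhdsWithin] with h (hh : 0 < h)
  rw [integral_mul_eq_integral_condDistrib (hS.measurable_predictor 0) (hS.measurable_response 0)
      hS.condDistrib hψ hD (φ := fun v => φ (h⁻¹ • (v - x))) (by fun_prop) fun _ => hC _,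
    hS.densities.density.integral_eq, eq_inv_mul_iff_mul_eq₀ (by positivity),
    ← integral_comp_rescale_mul φ m x hh]
  simp only [m, mul_assoc]

theorem LocallyRegularSample.tendsto_localAverage_real (hS : LocallyRegularSample μ X Y κ g x)
    (hh : Tendsto h atTop (𝓝[>] 0))
    (hnh : Tendsto (fun n : ℕ => n * h n ^ Module.finrank ℝ E) atTop atTop)
    {φ : E → ℝ} (hφ : Measurable φ) {C : ℝ} (hC : ∀ u, |φ u| ≤ C) (hsupp : HasCompactSupport φ)
    (hψ : Measurable ψ) (hD : ∀ y, |ψ y| ≤ D) (hψx : ContinuousAt (fun u => ∫ y, ψ y ∂κ u) x) :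
    Tendsto (fun z : ℕ × Ω => localAverage φ ψ x (h z.1) (fun i : Fin z.1 => X i z.2)
      fun i : Fin z.1 => Y i z.2) (highProbability μ atTop)
      (𝓝 ((∫ y, ψ y ∂κ x) * g x * ∫ u, φ u)) := by
  obtain ⟨R, hR, hsuppR⟩ := hsupp.isCompact.isBounded.subset_closedBall_lt 0 0
  obtain ⟨M, i₀, hM⟩ := hS.densities.exists_real_closedBall_le hS.measurable_predictor hR.le
  have hvanish : ∀ᶠ n in atTop, ∀ v ∉ Prod.fst ⁻¹' Metric.closedBall x (h n * R),
      ψ v.2 * φ ((h n)⁻¹ • (v.1 - x)) = 0 := by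
    filter_upwards [hh.eventually self_mem_nhdsWithin] with n (hn : 0 < h n) v hv
    refine mul_eq_zero_of_right _ (image_eq_zero_of_notMem_tsupport fun hmem => hv ?_)
    have := mem_closedBall_zero_iff.1 (hsuppR hmem)
    rwa [norm_smul, norm_inv, Real.norm_of_nonneg hn.le, inv_mul_le_iff₀ hn,
      ← mem_closedBall_iff_norm] at this
  simp only [localAverage, smul_eq_mul]
  exact tendsto_average_of_rare (V := fun i ω => (X i ω, Y i ω))
    (f := fun n v => ψ v.2 * φ ((h n)⁻¹ • (v.1 - x))) (C := D * C)
    (A := fun n => Prod.fst ⁻¹' Metric.closedBall x (h n * R))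
    (p := fun n => h n ^ Module.finrank ℝ E)
    (fun i => (hS.measurable_predictor i).prodMk (hS.measurable_response i)) hS.stationary
    hS.summable_sqrt_mixingCoeff (fun n => by fun_prop)
    (fun n v => (abs_mul _ _).trans_le
      (mul_le_mul (hD _) (hC _) (abs_nonneg _) ((abs_nonneg _).trans (hD v.2))))
    (fun n => measurable_fst Metric.isClosed_closedBall.measurableSet) hvanish hnh
    ((hh.eventually hM).mono fun _ => And.left) ((hh.eventually hM).mono fun _ => And.right)
    ((hS.tendsto_integral_localized hφ hC hsupp hψ hD hψx).comp hh)

lemma tendsto_nhds_of_forall_dual {α F : Type*} [NormedAddCommGroup F] [NormedSpace ℝ F]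
    [FiniteDimensional ℝ F] {l : Filter α} {u : α → F} {a : F}
    (hu : ∀ f : F →L[ℝ] ℝ, Tendsto (fun t => f (u t)) l (𝓝 (f a))) : Tendsto u l (𝓝 a) := by
  set e := (Module.finBasis ℝ F).equivFun.toContinuousLinearEquiv
  rw [e.toHomeomorph.isInducing.tendsto_nhds_iff, tendsto_pi_nhds]
  exact fun j => hu ((ContinuousLinearMap.proj (R := ℝ) j).comp e.toContinuousLinearMap)

lemma integrable_of_norm_le_of_hasCompactSupport {E F : Type*} [TopologicalSpace E]
    [MeasureSpace E] [OpensMeasurableSpace E] [IsFiniteMeasureOnCompacts (volume : Measure E)]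
    [NormedAddCommGroup F] {φ : E → F} (hφ : AEStronglyMeasurable φ) {C : ℝ}
    (hC : ∀ u, ‖φ u‖ ≤ C) (hsupp : HasCompactSupport φ) : Integrable φ :=
  (integrableOn_iff_integrable_of_support_subset (subset_tsupport φ)).1 <|
    Measure.integrableOn_of_bounded hsupp.isCompact.measure_ne_top hφ (ae_of_all _ hC)

theorem LocallyRegularSample.tendsto_localAverage [NormedAddCommGroup F] [NormedSpace ℝ F]
    [FiniteDimensional ℝ F] [MeasurableSpace F] [BorelSpace F]
    (hS : LocallyRegularSample μ X Y κ g x) (hh : Tendsto h atTop (𝓝[>] 0))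
    (hnh : Tendsto (fun n : ℕ => n * h n ^ Module.finrank ℝ E) atTop atTop)
    {φ : E → F} (hφ : Measurable φ) {C : ℝ} (hC : ∀ u, ‖φ u‖ ≤ C) (hsupp : HasCompactSupport φ)
    (hψ : Measurable ψ) (hD : ∀ y, |ψ y| ≤ D) (hψx : ContinuousAt (fun u => ∫ y, ψ y ∂κ u) x) :
    Tendsto (fun z : ℕ × Ω => localAverage φ ψ x (h z.1) (fun i : Fin z.1 => X i z.2)
      fun i : Fin z.1 => Y i z.2) (highProbability μ atTop)
      (𝓝 (((∫ y, ψ y ∂κ x) * g x) • ∫ u, φ u)) := by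
  have : ProperSpace F := FiniteDimensional.proper_real F
  have hint : Integrable φ :=
    integrable_of_norm_le_of_hasCompactSupport hφ.aestronglyMeasurable hC hsupp
  refine tendsto_nhds_of_forall_dual fun f => ?_
  have hfC (u : E) : |f (φ u)| ≤ ‖f‖ * C := f.le_of_opNorm_le_of_le le_rfl (hC u)
  simpa only [localAverage, map_smul, map_sum, smul_eq_mul, ← f.integral_comp_comm hint,
    Function.comp_apply] using
    hS.tendsto_localAverage_real hh hnh (f.measurable.comp hφ) hfC
      (hsupp.comp_left (map_zero f)) hψ hD hψx

lemma LocallyRegularSample.tendsto_localAverage_one [NormedAddCommGroup F] [NormedSpace ℝ F]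
    [FiniteDimensional ℝ F] [MeasurableSpace F] [BorelSpace F]
    (hS : LocallyRegularSample μ X Y κ g x) (hh : Tendsto h atTop (𝓝[>] 0))
    (hnh : Tendsto (fun n : ℕ => n * h n ^ Module.finrank ℝ E) atTop atTop)
    {φ : E → F} (hφ : Measurable φ) {C : ℝ} (hC : ∀ u, ‖φ u‖ ≤ C) (hsupp : HasCompactSupport φ) :
    Tendsto (fun z : ℕ × Ω => localAverage φ (fun _ => 1) x (h z.1)
      (fun i : Fin z.1 => X i z.2) fun i : Fin z.1 => Y i z.2) (highProbability μ atTop)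
      (𝓝 (g x • ∫ u, φ u)) := by
  simpa using hS.tendsto_localAverage (ψ := fun _ => 1) hh hnh hφ hC hsupp measurable_const
    (fun _ => abs_one.le) (by simpa using continuousAt_const)

end LocalAverage

section EmpiricalLikelihood

open scoped RealInnerProductSpace

lemma log_one_add_le_sub_sq {t : ℝ} (ht : |t| ≤ 1 / 5) : Real.log (1 + t) ≤ t - t ^ 2 / 4 := by
  have htaylor : |-t + (-t) ^ 2 / 2 + Real.log (1 + t)| ≤ |t| ^ 3 / (1 - |t|) := by
    have := Real.abs_log_sub_add_sum_range_le (x := -t) (by rw [abs_neg]; linarith) 2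
    norm_num [Finset.sum_range_succ] at this ⊢
    exact this
  have hrem : |t| ^ 3 / (1 - |t|) ≤ t ^ 2 / 4 := by
    rw [div_le_iff₀ (by linarith), ← sq_abs t]
    nlinarith [sq_nonneg |t|, abs_nonneg t]
  linarith [(abs_le.1 (htaylor.trans hrem)).2]

lemma abs_inv_one_add_sub_one_le {t s : ℝ} (hts : |t| ≤ s) (hs : s ≤ 1 / 5) :
    |(1 + t)⁻¹ - 1| ≤ 2 * s := by
  have ht := abs_le.1 hts
  have hpos : 0 < 1 + t := by linarith
  rw [show (1 + t)⁻¹ - 1 = -t / (1 + t) by field_simp; ring, abs_div, abs_neg, abs_of_pos hpos,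
    div_le_iff₀ hpos]
  nlinarith [abs_nonneg t]

section Multiplier

variable {ι E : Type*} [Fintype ι] [NormedAddCommGroup E] [InnerProductSpace ℝ E] {W : ι → E}
  {C r : ℝ}

lemma sum_log_one_add_inner_neg {l : E} (hl : ∀ i, |⟪l, W i⟫| ≤ 1 / 5)
    (hsq : 4 * ‖l‖ * ‖∑ i, W i‖ < ∑ i, ⟪l, W i⟫ ^ 2) : ∑ i, Real.log (1 + ⟪l, W i⟫) < 0 := by
  calc ∑ i, Real.log (1 + ⟪l, W i⟫) ≤ ∑ i, (⟪l, W i⟫ - ⟪l, W i⟫ ^ 2 / 4) :=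
        Finset.sum_le_sum fun i _ => log_one_add_le_sub_sq (hl i)
    _ = ⟪l, ∑ i, W i⟫ - (∑ i, ⟪l, W i⟫ ^ 2) / 4 := by
        rw [Finset.sum_sub_distrib, ← Finset.sum_div, inner_sum]
    _ < 0 := by linarith [real_inner_le_norm l (∑ i, W i)]

lemma hasFDerivAt_sum_log_one_add_inner {l : E} (hl : ∀ i, 1 + ⟪l, W i⟫ ≠ 0) :
    HasFDerivAt (fun l => ∑ i, Real.log (1 + ⟪l, W i⟫))
      (innerSL ℝ (∑ i, (1 + ⟪l, W i⟫)⁻¹ • W i)) l := by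
  simp only [map_sum, map_smul]
  refine HasFDerivAt.fun_sum fun i _ => HasFDerivAt.log (.const_add 1 ?_) (hl i)
  exact (innerSL ℝ (W i)).hasFDerivAt.congr_of_eventuallyEq
    (.of_forall fun l => real_inner_comm (W i) l)

/- On the sphere of radius `r` the quadratic term of `∑ log (1 + ⟪l, W i⟫)` dominates the linear
one, so the maximum over the ball is attained inside. -/
lemma exists_multiplier [FiniteDimensional ℝ E] (hW : ∀ i, ‖W i‖ ≤ C) (hr : 0 < r)
    (hrC : r * C ≤ 1 / 5)
    (hsq : ∀ l : E, ‖l‖ = r → 4 * r * ‖∑ i, W i‖ < ∑ i, ⟪l, W i⟫ ^ 2) :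
    ∃ l : E, (∀ i, |⟪l, W i⟫| ≤ r * C) ∧ ∑ i, (1 + ⟪l, W i⟫)⁻¹ • W i = 0 := by
  have : ProperSpace E := FiniteDimensional.proper_real E
  have hle {l : E} (hl : l ∈ Metric.closedBall 0 r) (i : ι) : |⟪l, W i⟫| ≤ r * C :=
    (abs_real_inner_le_norm l (W i)).trans
      (mul_le_mul (mem_closedBall_zero_iff.1 hl) (hW i) (norm_nonneg _) hr.le)
  have hne (l : E) (hl : l ∈ Metric.closedBall 0 r) (i : ι) : 1 + ⟪l, W i⟫ ≠ 0 := by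
    have := (abs_le.1 (hle hl i)).1
    linarith
  obtain ⟨l, hl, hmax⟩ := (isCompact_closedBall (0 : E) r).exists_isMaxOn
    ⟨0, Metric.mem_closedBall_self hr.le⟩ fun l hl =>
      (hasFDerivAt_sum_log_one_add_inner (hne l hl)).continuousAt.continuousWithinAt
  refine ⟨l, hle hl, ?_⟩
  have hinterior : ‖l‖ < r := by
    refine (mem_closedBall_zero_iff.1 hl).lt_of_ne fun hlr => ?_
    have hneg := sum_log_one_add_inner_neg (fun i => (hle hl i).trans hrC) (hlr ▸ hsq l hlr)
    have hzero : ∑ i, Real.log (1 + ⟪(0 : E), W i⟫) ≤ ∑ i, Real.log (1 + ⟪l, W i⟫) :=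
      hmax (Metric.mem_closedBall_self hr.le)
    simp only [inner_zero_left, add_zero, Real.log_one, Finset.sum_const_zero] at hzero
    exact hneg.not_ge hzero
  have hcrit := (hmax.isLocalMax (Metric.closedBall_mem_nhds_of_mem
    (mem_ball_zero_iff.2 hinterior))).hasFDerivAt_eq_zero
      (hasFDerivAt_sum_log_one_add_inner (hne l hl))
  rwa [← norm_eq_zero, innerSL_apply_norm, norm_eq_zero] at hcrit

lemma sum_inv_one_add_inner {l : E} (hl : ∀ i, 1 + ⟪l, W i⟫ ≠ 0)
    (hzero : ∑ i, (1 + ⟪l, W i⟫)⁻¹ • W i = 0) :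
    ∑ i, (1 + ⟪l, W i⟫)⁻¹ = Fintype.card ι := by
  have hinner : ∑ i, (1 + ⟪l, W i⟫)⁻¹ * ⟪l, W i⟫ = 0 := by
    simpa only [inner_sum, real_inner_smul_right, inner_zero_right] using
      congrArg (fun v => ⟪l, v⟫) hzero
  calc ∑ i, (1 + ⟪l, W i⟫)⁻¹ = ∑ i, ((1 + ⟪l, W i⟫)⁻¹ + (1 + ⟪l, W i⟫)⁻¹ * ⟪l, W i⟫) := by
        rw [Finset.sum_add_distrib, hinner, add_zero]
    _ = ∑ _i : ι, (1 : ℝ) :=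
        Finset.sum_congr rfl fun i _ => by rw [← mul_one_add, inv_mul_cancel₀ (hl i)]
    _ = Fintype.card ι := by simp

end Multiplier

lemma sum_log_lt_sum_log {ι : Type*} [Fintype ι] {p q : ι → ℝ} (hp : ∀ i, 0 < p i)
    (hq : ∀ i, 0 < q i) (hsum : ∑ i, q i / p i ≤ Fintype.card ι) (hne : q ≠ p) :
    ∑ i, Real.log (q i) < ∑ i, Real.log (p i) := by
  obtain ⟨j, hj⟩ := Function.ne_iff.1 hne
  have hlog : ∑ i, Real.log (q i / p i) < ∑ i, (q i / p i - 1) :=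
    Finset.sum_lt_sum (fun i _ => Real.log_le_sub_one_of_pos (div_pos (hq i) (hp i)))
      ⟨j, Finset.mem_univ j, Real.log_lt_sub_one_of_pos (div_pos (hq j) (hp j))
        fun h => hj ((div_eq_one_iff_eq (hp j).ne').1 h)⟩
  simp only [Real.log_div (hq _).ne' (hp _).ne', Finset.sum_sub_distrib, Finset.sum_const,
    Finset.card_univ, nsmul_eq_mul, mul_one] at hlog
  linarith

section AdjustmentWeights

variable {w n : ℕ} {K : EuclideanSpace ℝ (Fin w) → ℝ} {h : ℝ}
  {X : Fin n → EuclideanSpace ℝ (Fin w)} {x : EuclideanSpace ℝ (Fin w)} {p : Fin n → ℝ}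

lemma adjustmentWeights_nonneg (i : Fin n) : 0 ≤ adjustmentWeights K h X x i := by
  unfold adjustmentWeights
  split_ifs with hp
  · exact (hp.choose_spec.feasible.pos i).le
  · positivity

lemma IsFeasible.adjustmentWeights_eq (hp : IsFeasible K h X x p)
    (hmax : ∀ q, IsFeasible K h X x q → q ≠ p → ∑ i, Real.log (q i) < ∑ i, Real.log (p i)) :
    adjustmentWeights K h X x = p := by
  have hadj : IsAdjustment K h X x p := by
    refine ⟨hp, fun q hq => ?_⟩
    rcases eq_or_ne q p with rfl | hne
    exacts [le_rfl, (hmax q hq hne).le]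
  have hex : ∃ p, IsAdjustment K h X x p := ⟨p, hadj⟩
  unfold adjustmentWeights
  rw [dif_pos hex]
  by_contra hne
  exact (hmax _ hex.choose_spec.feasible hne).not_ge (hex.choose_spec.maximal p hp)

/-- The vector `K(U) U` of the rescaled position `U = h⁻¹ (u - x)`: up to a positive factor, the
summand of the moment constraint on the weights. -/
noncomputable def rescaledMoment (K : EuclideanSpace ℝ (Fin w) → ℝ) (h : ℝ)
    (x u : EuclideanSpace ℝ (Fin w)) : EuclideanSpace ℝ (Fin w) :=
  K (h⁻¹ • (u - x)) • h⁻¹ • (u - x)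

lemma sum_scaledKernel_smul_eq_zero_iff (hh : 0 < h) :
    ∑ i, (p i * scaledKernel K h (X i - x)) • (X i - x) = 0
      ↔ ∑ i, p i • rescaledMoment K h x (X i) = 0 := by
  have hfactor : ∑ i, (p i * scaledKernel K h (X i - x)) • (X i - x)
      = ((h ^ w)⁻¹ * h) • ∑ i, p i • rescaledMoment K h x (X i) := by
    rw [Finset.smul_sum]
    refine Finset.sum_congr rfl fun i _ => ?_
    simp only [scaledKernel, rescaledMoment, smul_smul]
    congr 1
    field_simp
  rw [hfactor, smul_eq_zero, or_iff_right (by positivity)]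

lemma mul_adjustmentWeights_eq (hn : 0 < n) (hh : 0 < h) {l : EuclideanSpace ℝ (Fin w)}
    (hpos : ∀ i, 0 < 1 + ⟪l, rescaledMoment K h x (X i)⟫)
    (hzero : ∑ i, (1 + ⟪l, rescaledMoment K h x (X i)⟫)⁻¹ • rescaledMoment K h x (X i) = 0)
    (i : Fin n) :
    n * adjustmentWeights K h X x i = (1 + ⟪l, rescaledMoment K h x (X i)⟫)⁻¹ := by
  have hn' : (0 : ℝ) < n := Nat.cast_pos.2 hn
  set W := fun i => rescaledMoment K h x (X i)
  set p := fun i => (n : ℝ)⁻¹ * (1 + ⟪l, W i⟫)⁻¹ with hp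
  have hp0 (i : Fin n) : 0 < p i := mul_pos (inv_pos.2 hn') (inv_pos.2 (hpos i))
  have hfeas : IsFeasible K h X x p := by
    refine ⟨hp0, ?_, (sum_scaledKernel_smul_eq_zero_iff hh).2 ?_⟩
    · rw [← Finset.mul_sum, sum_inv_one_add_inner (fun i => (hpos i).ne') hzero, Fintype.card_fin,
        inv_mul_cancel₀ hn'.ne']
    · simp only [hp, mul_smul, ← Finset.smul_sum]
      exact smul_eq_zero_of_right _ hzero
  have hratio (q : Fin n → ℝ) (hq : IsFeasible K h X x q) :
      ∑ i, q i / p i = Fintype.card (Fin n) := by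
    have horth : ∑ i, q i * ⟪l, W i⟫ = 0 := by
      simpa only [inner_sum, real_inner_smul_right, inner_zero_right] using
        congrArg (fun v => ⟪l, v⟫) ((sum_scaledKernel_smul_eq_zero_iff hh).1 hq.moment)
    calc ∑ i, q i / p i = n * (∑ i, q i + ∑ i, q i * ⟪l, W i⟫) := by
          rw [← Finset.sum_add_distrib, Finset.mul_sum]
          refine Finset.sum_congr rfl fun i _ => ?_
          simp only [hp, div_eq_mul_inv, mul_inv, inv_inv]
          ring
      _ = Fintype.card (Fin n) := by
          rw [hq.sum_eq_one, horth, add_zero, mul_one, Fintype.card_fin]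
  rw [hfeas.adjustmentWeights_eq fun q hq hne =>
    sum_log_lt_sum_log hp0 hq.pos (hratio q hq).le hne]
  exact mul_inv_cancel_left₀ hn'.ne' _

lemma abs_mul_adjustmentWeights_sub_one_le (hh : 0 < h) {C r : ℝ}
    (hC : ∀ u : EuclideanSpace ℝ (Fin w), ‖K u • u‖ ≤ C) (hr : 0 < r) (hrC : r * C ≤ 1 / 5)
    (hsq : ∀ l : EuclideanSpace ℝ (Fin w), ‖l‖ = r →
      4 * r * ‖∑ i, rescaledMoment K h x (X i)‖ < ∑ i, ⟪l, rescaledMoment K h x (X i)⟫ ^ 2)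
    (i : Fin n) : |n * adjustmentWeights K h X x i - 1| ≤ 2 * (r * C) := by
  obtain ⟨l, hl, hzero⟩ := exists_multiplier (fun i => hC (h⁻¹ • (X i - x))) hr hrC hsq
  have hpos (i : Fin n) : 0 < 1 + ⟪l, rescaledMoment K h x (X i)⟫ := by
    have := (abs_le.1 (hl i)).1
    unfold rescaledMoment
    linarith
  rw [mul_adjustmentWeights_eq i.pos hh hpos hzero]
  exact abs_inv_one_add_sub_one_le (hl i) hrC

end AdjustmentWeights

end EmpiricalLikelihood

section CenteredKernel

open scoped RealInnerProductSpace

variable {E : Type*} [NormedAddCommGroup E] [InnerProductSpace ℝ E] {K : E → ℝ}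

lemma exists_eventually_mul_norm_sq_le_inner {α : Type*} [FiniteDimensional ℝ E] {f : Filter α}
    {A : α → E →L[ℝ] E} {S : E →L[ℝ] E} (hA : Tendsto A f (𝓝 S))
    (hS : ∀ l ≠ 0, 0 < ⟪l, S l⟫) :
    ∃ c > 0, ∀ᶠ t in f, ∀ l, c * ‖l‖ ^ 2 ≤ ⟪l, A t l⟫ := by
  have : ProperSpace E := FiniteDimensional.proper_real E
  obtain ⟨c, hc, hcS⟩ : ∃ c > 0, ∀ l ∈ Metric.sphere (0 : E) 1, c ≤ ⟪l, S l⟫ :=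
    (isCompact_sphere (0 : E) 1).exists_forall_le' (by fun_prop)
      fun l hl => hS l (ne_zero_of_mem_unit_sphere ⟨l, hl⟩)
  have hSc (l : E) : c * ‖l‖ ^ 2 ≤ ⟪l, S l⟫ := by
    rcases eq_or_ne l 0 with rfl | hl
    · simp
    have hunit := hcS (‖l‖⁻¹ • l) (by simp [norm_smul, hl])
    rw [map_smul, real_inner_smul_left, real_inner_smul_right, ← mul_assoc, ← mul_inv, ← sq,
      le_inv_mul_iff₀ (by positivity)] at hunit
    linarith
  refine ⟨c / 2, half_pos hc, ?_⟩
  filter_upwards [Metric.tendsto_nhds.1 hA (c / 2) (half_pos hc)] with t ht l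
  have hdiff : |⟪l, (A t - S) l⟫| ≤ c / 2 * ‖l‖ ^ 2 := by
    rw [dist_eq_norm] at ht
    nlinarith [abs_real_inner_le_norm l ((A t - S) l), (A t - S).le_of_opNorm_le ht.le l,
      norm_nonneg l]
  rw [sub_apply, inner_sub_right] at hdiff
  linarith [(abs_le.1 hdiff).1, hSc l]

/-- The outer product of `K u • u` with itself, as an operator: the summand of the second-order
term of the empirical likelihood. -/
noncomputable def momentOuter (K : E → ℝ) (u : E) : E →L[ℝ] E :=
  InnerProductSpace.rankOne ℝ (K u • u) (K u • u)

lemma inner_momentOuter (l u : E) : ⟪l, momentOuter K u l⟫ = ⟪l, K u • u⟫ ^ 2 := by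
  rw [momentOuter, InnerProductSpace.rankOne_apply, real_inner_smul_right _ _ ⟪K u • u, l⟫,
    real_inner_comm, sq]

lemma norm_momentOuter_le {C : ℝ} (hC : ∀ u, ‖K u • u‖ ≤ C) (u : E) :
    ‖momentOuter K u‖ ≤ C * C := by
  rw [momentOuter, InnerProductSpace.norm_rankOne]
  exact mul_self_le_mul_self (norm_nonneg _) (hC u)

lemma hasCompactSupport_momentOuter (hK : HasCompactSupport K) :
    HasCompactSupport (momentOuter K) :=
  hK.mono' fun u hu => subset_tsupport K fun h0 => hu <| by simp [momentOuter, h0]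

lemma measurable_momentOuter [FiniteDimensional ℝ E] [MeasurableSpace E] [BorelSpace E]
    [MeasurableSpace (E →L[ℝ] E)] [BorelSpace (E →L[ℝ] E)] (hK : Measurable K) :
    Measurable (momentOuter K) := by
  have hcont : Continuous fun v : E => InnerProductSpace.rankOne ℝ v v :=
    (InnerProductSpace.rankOne ℝ).continuous.clm_apply continuous_id
  exact hcont.measurable.comp (hK.smul measurable_id)

/-- A bounded nonnegative kernel of compact support and positive mass whose first moment
vanishes. -/
structure IsCenteredKernel [MeasureSpace E] (K : E → ℝ) : Prop where
  measurable : Measurable K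
  nonneg : ∀ u, 0 ≤ K u
  bounded : ∃ C : ℝ, ∀ u, K u ≤ C
  hasCompactSupport : HasCompactSupport K
  integral_pos : 0 < ∫ u, K u
  first_moment : ∫ u, K u • u = 0

variable [MeasureSpace E]

lemma IsCenteredKernel.exists_norm_smul_le (hK : IsCenteredKernel K) :
    ∃ C > 0, ∀ u, ‖K u • u‖ ≤ C := by
  obtain ⟨B, hB⟩ := hK.bounded
  obtain ⟨R, hR, hsupp⟩ := hK.hasCompactSupport.isCompact.isBounded.subset_closedBall_lt 0 0
  have hB0 : 0 ≤ B := (hK.nonneg 0).trans (hB 0)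
  refine ⟨B * R + 1, by positivity, fun u => ?_⟩
  by_cases hu : u ∈ tsupport K
  · rw [norm_smul, Real.norm_of_nonneg (hK.nonneg u)]
    have := mul_le_mul (hB u) (mem_closedBall_zero_iff.1 (hsupp hu)) (norm_nonneg u) hB0
    linarith
  · rw [image_eq_zero_of_notMem_tsupport hu, zero_smul, norm_zero]
    positivity

variable [FiniteDimensional ℝ E] [BorelSpace E] [(volume : Measure E).IsAddHaarMeasure]

lemma ae_inner_ne_zero {l : E} (hl : l ≠ 0) : ∀ᵐ u : E, ⟪l, u⟫ ≠ 0 := by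
  have hproper : (ℝ ∙ l)ᗮ ≠ ⊤ := fun htop => hl <| inner_self_eq_zero.1 <|
    Submodule.mem_orthogonal_singleton_iff_inner_right.1 (htop ▸ Submodule.mem_top : l ∈ (ℝ ∙ l)ᗮ)
  refine measure_mono_null (fun u hu => ?_) (Measure.addHaar_submodule volume _ hproper)
  exact Submodule.mem_orthogonal_singleton_iff_inner_right.2 (not_not.1 hu)

lemma IsCenteredKernel.integrable_momentOuter (hK : IsCenteredKernel K) :
    Integrable (momentOuter K) := by
  borelize (E →L[ℝ] E)
  obtain ⟨C, -, hC⟩ := hK.exists_norm_smul_le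
  exact integrable_of_norm_le_of_hasCompactSupport
    (measurable_momentOuter hK.measurable).aestronglyMeasurable (norm_momentOuter_le hC)
    (hasCompactSupport_momentOuter hK.hasCompactSupport)

lemma IsCenteredKernel.inner_integral_momentOuter_pos (hK : IsCenteredKernel K) {l : E}
    (hl : l ≠ 0) : 0 < ⟪l, (∫ u, momentOuter K u) l⟫ := by
  set f : (E →L[ℝ] E) →L[ℝ] ℝ := (innerSL ℝ l).comp (ContinuousLinearMap.apply ℝ E l)
  have hf (u : E) : f (momentOuter K u) = ⟪l, K u • u⟫ ^ 2 := inner_momentOuter l u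
  have hint : Integrable fun u => ⟪l, K u • u⟫ ^ 2 :=
    (f.integrable_comp hK.integrable_momentOuter).congr (ae_of_all _ hf)
  have hquad : ⟪l, (∫ u, momentOuter K u) l⟫ = ∫ u, ⟪l, K u • u⟫ ^ 2 :=
    (f.integral_comp_comm hK.integrable_momentOuter).symm.trans (integral_congr_ae (ae_of_all _ hf))
  rw [hquad]
  refine (integral_nonneg fun u => sq_nonneg _).lt_of_ne' fun hzero => hK.integral_pos.ne' ?_
  refine integral_eq_zero_of_ae ?_
  filter_upwards [(integral_eq_zero_iff_of_nonneg (fun u => sq_nonneg _) hint).1 hzero,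
    ae_inner_ne_zero hl] with u hu hlu
  simpa [real_inner_smul_right, hlu] using hu

end CenteredKernel

section WeightConvergence

open scoped RealInnerProductSpace

variable {w : ℕ} {K : EuclideanSpace ℝ (Fin w) → ℝ} {x : EuclideanSpace ℝ (Fin w)}

lemma abs_mul_adjustmentWeights_sub_one_le_of_localAverage {n : ℕ} {T : Type*} {h : ℝ}
    {X : Fin n → EuclideanSpace ℝ (Fin w)} {Y : Fin n → T} (hh : 0 < h) {c C r : ℝ}
    (hC : ∀ u : EuclideanSpace ℝ (Fin w), ‖K u • u‖ ≤ C) (hr : 0 < r) (hrC : r * C ≤ 1 / 5)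
    (hlin : 4 * ‖localAverage (fun u => K u • u) (fun _ => 1) x h X Y‖ < c * r)
    (hquad : ∀ l, c * ‖l‖ ^ 2 ≤ ⟪l, localAverage (momentOuter K) (fun _ => 1) x h X Y l⟫)
    (i : Fin n) : |n * adjustmentWeights K h X x i - 1| ≤ 2 * (r * C) := by
  refine abs_mul_adjustmentWeights_sub_one_le hh hC hr hrC (fun l hl => ?_) i
  have hscale : 0 < (n * h ^ w)⁻¹ := by have := i.pos; positivity
  have hquad_l := hquad l
  simp only [localAverage, finrank_euclideanSpace_fin, one_smul] at hlin hquad_l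
  rw [norm_smul, Real.norm_of_nonneg hscale.le] at hlin
  rw [hl, smul_apply, real_inner_smul_right, sum_apply, inner_sum] at hquad_l
  simp only [inner_momentOuter] at hquad_l
  refine lt_of_mul_lt_mul_left ?_ hscale.le
  unfold rescaledMoment
  nlinarith

variable {Ω T : Type*} [MeasurableSpace Ω] [MeasurableSpace T] {μ : Measure Ω}
  [IsProbabilityMeasure μ] {h : ℕ → ℝ} {X : ℕ → Ω → EuclideanSpace ℝ (Fin w)} {Y : ℕ → Ω → T}
  {κ : Kernel (EuclideanSpace ℝ (Fin w)) T} [IsMarkovKernel κ] {g : EuclideanSpace ℝ (Fin w) → ℝ}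

theorem LocallyRegularSample.eventually_abs_mul_adjustmentWeights_sub_one_le
    (hS : LocallyRegularSample μ X Y κ g x) (hg : 0 < g x) (hK : IsCenteredKernel K)
    (hh : Tendsto h atTop (𝓝[>] 0)) (hnh : Tendsto (fun n : ℕ => n * h n ^ w) atTop atTop)
    {η : ℝ} (hη : 0 < η) :
    ∀ᶠ z in highProbability μ atTop, ∀ i : Fin z.1,
      |z.1 * adjustmentWeights K (h z.1) (fun i => X i z.2) x i - 1| ≤ η := by
  borelize (EuclideanSpace ℝ (Fin w) →L[ℝ] EuclideanSpace ℝ (Fin w))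
  obtain ⟨C, hC0, hC⟩ := hK.exists_norm_smul_le
  rw [← finrank_euclideanSpace_fin (𝕜 := ℝ) (n := w)] at hnh
  have hlin := hS.tendsto_localAverage_one hh hnh (φ := fun u => K u • u)
    (hK.measurable.smul measurable_id) hC hK.hasCompactSupport.smul_right
  rw [hK.first_moment, smul_zero, tendsto_zero_iff_norm_tendsto_zero] at hlin
  have houter := hS.tendsto_localAverage_one hh hnh (measurable_momentOuter hK.measurable)
    (norm_momentOuter_le hC) (hasCompactSupport_momentOuter hK.hasCompactSupport)
  obtain ⟨c, hc, hquad⟩ := exists_eventually_mul_norm_sq_le_inner houter fun l hl => by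
    rw [smul_apply, real_inner_smul_right]
    exact mul_pos hg (hK.inner_integral_momentOuter_pos hl)
  set r := min (1 / 5) (η / 2) / C
  have hr : 0 < r := by positivity
  have hrC : r * C = min (1 / 5) (η / 2) := div_mul_cancel₀ _ hC0.ne'
  filter_upwards [hquad, hlin.eventually_lt_const (show 0 < c * r / 4 by positivity),
    tendsto_fst_highProbability.eventually (hh.eventually self_mem_nhdsWithin)]
    with z hquad_z hlin_z (hh_z : 0 < h z.1) i
  refine (abs_mul_adjustmentWeights_sub_one_le_of_localAverage hh_z hC hr
    (hrC.trans_le (min_le_left _ _)) (by linarith) hquad_z i).trans ?_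
  linarith [min_le_right (1 / 5) (η / 2)]

end WeightConvergence

section Estimator

variable {w n : ℕ} {K : EuclideanSpace ℝ (Fin w) → ℝ} {x : EuclideanSpace ℝ (Fin w)}

lemma adjustmentWeights_mul_scaledKernel_nonneg {h : ℝ} (hK : ∀ u, 0 ≤ K u) (hh : 0 < h)
    {X : Fin n → EuclideanSpace ℝ (Fin w)} (i : Fin n) :
    0 ≤ adjustmentWeights K h X x i * scaledKernel K h (X i - x) :=
  mul_nonneg (adjustmentWeights_nonneg i) (mul_nonneg (by positivity) (hK _))

lemma estCDF_mono {h : ℝ} (hK : ∀ u, 0 ≤ K u) (hh : 0 < h) {X : Fin n → EuclideanSpace ℝ (Fin w)}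
    {Y : Fin n → ℝ} : Monotone (estCDF K h X Y x) := fun _ _ hab =>
  Finset.sum_le_sum fun i _ => mul_le_mul_of_nonneg_left
    (Set.indicator_le_indicator_of_subset (Set.Iic_subset_Iic.2 hab) (fun _ => zero_le_one) _)
    (div_nonneg (adjustmentWeights_mul_scaledKernel_nonneg hK hh i)
      (Finset.sum_nonneg fun j _ => adjustmentWeights_mul_scaledKernel_nonneg hK hh j))

/-- The average of `ψ (Y i)` with the adjusted kernel weights, before normalization: numerator and
denominator of `estCDF` are of this form. -/
noncomputable def adjustedAverage {T : Type*} (K : EuclideanSpace ℝ (Fin w) → ℝ) (ψ : T → ℝ)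
    (x : EuclideanSpace ℝ (Fin w)) (h : ℝ) (X : Fin n → EuclideanSpace ℝ (Fin w))
    (Y : Fin n → T) : ℝ :=
  ∑ i, adjustmentWeights K h X x i * scaledKernel K h (X i - x) * ψ (Y i)

lemma estCDF_eq_div {h : ℝ} {X : Fin n → EuclideanSpace ℝ (Fin w)} {Y : Fin n → ℝ} (b : ℝ) :
    estCDF K h X Y x b = adjustedAverage K ((Set.Iic b).indicator fun _ => 1) x h X Y
      / adjustedAverage K (fun _ => 1) x h X Y := by
  simp only [estCDF, finalWeights, adjustedAverage, Finset.sum_div, mul_one, div_mul_eq_mul_div]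

lemma abs_adjustedAverage_sub_localAverage_le {T : Type*} {h : ℝ}
    {X : Fin n → EuclideanSpace ℝ (Fin w)} {Y : Fin n → T} {ψ : T → ℝ} (hK : ∀ u, 0 ≤ K u)
    (hh : 0 < h) (hψ : ∀ y, 0 ≤ ψ y) {η : ℝ}
    (hη : ∀ i, |n * adjustmentWeights K h X x i - 1| ≤ η) :
    |adjustedAverage K ψ x h X Y - localAverage K ψ x h X Y|
      ≤ η * localAverage K ψ x h X Y := by
  have hterm (i : Fin n) : adjustmentWeights K h X x i * scaledKernel K h (X i - x) * ψ (Y i)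
      - (n * h ^ w)⁻¹ * (ψ (Y i) * K (h⁻¹ • (X i - x)))
      = (n * adjustmentWeights K h X x i - 1)
        * ((n * h ^ w)⁻¹ * (ψ (Y i) * K (h⁻¹ • (X i - x)))) := by
    have hn : (n : ℝ) ≠ 0 := Nat.cast_ne_zero.2 i.pos.ne'
    unfold scaledKernel
    field_simp
  simp only [adjustedAverage, localAverage, finrank_euclideanSpace_fin, smul_eq_mul,
    Finset.mul_sum, ← Finset.sum_sub_distrib, hterm]
  refine (Finset.abs_sum_le_sum_abs _ _).trans (Finset.sum_le_sum fun i _ => ?_)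
  have hnonneg : 0 ≤ (n * h ^ w)⁻¹ * (ψ (Y i) * K (h⁻¹ • (X i - x))) :=
    mul_nonneg (by positivity) (mul_nonneg (hψ _) (hK _))
  rw [abs_mul, abs_of_nonneg hnonneg]
  exact mul_le_mul_of_nonneg_right (hη i) hnonneg

variable {Ω T : Type*} [MeasurableSpace Ω] [MeasurableSpace T] {μ : Measure Ω}
  [IsProbabilityMeasure μ] {g : EuclideanSpace ℝ (Fin w) → ℝ} {h : ℕ → ℝ}
  {X : ℕ → Ω → EuclideanSpace ℝ (Fin w)}

lemma LocallyRegularSample.isEquivalent_adjustedAverage {Y : ℕ → Ω → T}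
    {κ : Kernel (EuclideanSpace ℝ (Fin w)) T} [IsMarkovKernel κ]
    (hS : LocallyRegularSample μ X Y κ g x) (hg : 0 < g x) (hK : IsCenteredKernel K)
    (hh : Tendsto h atTop (𝓝[>] 0)) (hnh : Tendsto (fun n : ℕ => n * h n ^ w) atTop atTop)
    {ψ : T → ℝ} (hψ : ∀ y, 0 ≤ ψ y) :
    (fun z : ℕ × Ω => adjustedAverage K ψ x (h z.1) (fun i : Fin z.1 => X i z.2)
      fun i : Fin z.1 => Y i z.2) ~[highProbability μ atTop]
    fun z => localAverage K ψ x (h z.1) (fun i : Fin z.1 => X i z.2)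
      fun i : Fin z.1 => Y i z.2 := by
  refine isLittleO_iff.2 fun η hη => ?_
  filter_upwards [hS.eventually_abs_mul_adjustmentWeights_sub_one_le hg hK hh hnh hη,
    tendsto_fst_highProbability.eventually (hh.eventually self_mem_nhdsWithin)]
    with z hweights (hh_z : 0 < h z.1)
  exact (abs_adjustedAverage_sub_localAverage_le hK.nonneg hh_z hψ hweights).trans
    (mul_le_mul_of_nonneg_left (le_abs_self _) hη.le)

theorem LocallyRegularSample.tendsto_estCDF {Y : ℕ → Ω → ℝ}
    {κ : Kernel (EuclideanSpace ℝ (Fin w)) ℝ} [IsMarkovKernel κ]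
    (hS : LocallyRegularSample μ X Y κ g x) (hg : 0 < g x) (hK : IsCenteredKernel K)
    (hh : Tendsto h atTop (𝓝[>] 0)) (hnh : Tendsto (fun n : ℕ => n * h n ^ w) atTop atTop)
    {b : ℝ} (hb : ContinuousAt (condCDF κ b) x) :
    Tendsto (fun z : ℕ × Ω => estCDF K (h z.1) (fun i : Fin z.1 => X i z.2)
      (fun i : Fin z.1 => Y i z.2) x b) (highProbability μ atTop) (𝓝 (condCDF κ b x)) := by
  obtain ⟨C, hC⟩ := hK.bounded
  replace hC (u) : ‖K u‖ ≤ C := (Real.norm_of_nonneg (hK.nonneg u)).trans_le (hC u)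
  have hnh' := hnh
  rw [← finrank_euclideanSpace_fin (𝕜 := ℝ) (n := w)] at hnh'
  set ψ : ℝ → ℝ := (Set.Iic b).indicator fun _ => 1
  have hψ0 (y : ℝ) : 0 ≤ ψ y := Set.indicator_nonneg (fun _ _ => zero_le_one) y
  have hψ1 (y : ℝ) : |ψ y| ≤ 1 := by
    rw [abs_of_nonneg (hψ0 y)]
    exact Set.indicator_le_self' (fun _ _ => zero_le_one) y
  have hcdf (u : EuclideanSpace ℝ (Fin w)) : ∫ y, ψ y ∂κ u = condCDF κ b u :=
    integral_indicator_one measurableSet_Iic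
  have hnum := hS.tendsto_localAverage hh hnh' hK.measurable hC hK.hasCompactSupport
    (measurable_const.indicator measurableSet_Iic : Measurable ψ) hψ1
    (hb.congr (.of_forall fun u => (hcdf u).symm))
  have hden := hS.tendsto_localAverage_one hh hnh' hK.measurable hC hK.hasCompactSupport
  have hmass : 0 < g x * ∫ u, K u := mul_pos hg hK.integral_pos
  simp only [estCDF_eq_div]
  have hlim := ((hS.isEquivalent_adjustedAverage hg hK hh hnh hψ0).symm.tendsto_nhds hnum).div
    ((hS.isEquivalent_adjustedAverage hg hK hh hnh fun _ => zero_le_one).symm.tendsto_nhds hden)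
    hmass.ne'
  rwa [hcdf, smul_eq_mul, smul_eq_mul, mul_assoc, mul_div_cancel_right₀ _ hmass.ne'] at hlim

end Estimator

section Quantile

lemma abs_quantile_sub_le {G : ℝ → ℝ} (hG : Monotone G) {β Q ε : ℝ}
    (hlo : G (Q - ε) < β) (hhi : β ≤ G (Q + ε)) : |quantile G β - Q| ≤ ε := by
  have hlower : ∀ y ∈ {y : ℝ | β ≤ G y}, Q - ε ≤ y := fun y hy =>
    (hG.reflect_lt (hlo.trans_le hy)).le
  exact abs_sub_le_iff.2 ⟨sub_le_iff_le_add'.2 (csInf_le ⟨Q - ε, hlower⟩ hhi),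
    sub_le_comm.1 (le_csInf ⟨Q + ε, hhi⟩ hlower)⟩

lemma condCDF_lt_of_lt_quantile {E : Type*} [MeasurableSpace E] {κ : Kernel E ℝ}
    [IsMarkovKernel κ] {x : E} {β y : ℝ} (hβ : 0 < β)
    (hy : y < quantile (fun b => condCDF κ b x) β) : condCDF κ y x < β := by
  have hlim : Tendsto (fun b => condCDF κ b x) atBot (𝓝 0) :=
    (tendsto_cdf_atBot (κ x)).congr (cdf_eq_real (κ x))
  obtain ⟨z, hz⟩ := eventually_atBot.1 (hlim.eventually_lt_const hβ)
  contrapose! hy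
  exact csInf_le ⟨z, fun b hb => not_lt.1 fun hbz => (hz b hbz.le).not_ge hb⟩ hy

end Quantile

section Assumptions

variable {Ω : Type*} [MeasurableSpace Ω] {μ : Measure Ω} {w : ℕ}

lemma KernelAssumption.isCenteredKernel {K : EuclideanSpace ℝ (Fin w) → ℝ}
    (hK : KernelAssumption K) : IsCenteredKernel K where
  measurable := hK.continuous.measurable
  nonneg := hK.nonneg
  bounded := hK.bounded
  hasCompactSupport := hK.compactSupport
  integral_pos := hK.integral_eq_one ▸ one_pos
  first_moment := hK.first_moment

lemma BandwidthAssumption.tendsto_nhdsGT {δ : ℝ} {h : ℕ → ℝ} (hh : BandwidthAssumption w δ h) :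
    Tendsto h atTop (𝓝[>] 0) :=
  tendsto_nhdsWithin_iff.2 ⟨hh.tendsto_zero, .of_forall hh.pos⟩

lemma BandwidthAssumption.tendsto_mul_pow {δ : ℝ} (hδ : 0 < δ) {h : ℕ → ℝ}
    (hh : BandwidthAssumption w δ h) : Tendsto (fun n : ℕ => n * h n ^ w) atTop atTop := by
  refine tendsto_atTop_mono' _ ?_ hh.tendsto_atTop
  filter_upwards [hh.tendsto_zero.eventually_le_const one_pos] with n hn
  have hexponent : (w : ℝ) ≤ w * (1 + 2 / δ) :=
    le_mul_of_one_le_right (by positivity) (le_add_of_nonneg_right (by positivity))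
  rw [← Real.rpow_natCast]
  exact mul_le_mul_of_nonneg_left
    (Real.rpow_le_rpow_of_exponent_ge (hh.pos n) hn hexponent) n.cast_nonneg

lemma SmoothnessAssumption.hasLocalDensities {X : ℕ → Ω → EuclideanSpace ℝ (Fin w)}
    {κ : Kernel (EuclideanSpace ℝ (Fin w)) ℝ} {g : EuclideanSpace ℝ (Fin w) → ℝ}
    {x : EuclideanSpace ℝ (Fin w)} (hsmooth : SmoothnessAssumption μ X κ g x)
    (hg : IsDensity (μ.map (X 0)) g) : HasLocalDensities μ X g x where
  density := hg
  continuousAt := hsmooth.density_continuousAt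
  joint_density := by
    obtain ⟨M, -, i₀, hM⟩ := hsmooth.joint_density
    have hle : ∀ᶠ u in 𝓝 x, g u ≤ g x + 1 :=
      hsmooth.density_continuousAt.eventually_le_const (lt_add_one _)
    refine ⟨M + (g x + 1) * (g x + 1), _, hle, eventually_atTop.2 ⟨i₀, fun i hi => ?_⟩⟩
    obtain ⟨g₂, hg₂, hdiff⟩ := hM i hi
    refine ⟨g₂, hg₂, fun u (hu : g u ≤ g x + 1) v (hv : g v ≤ g x + 1) => ?_⟩
    have hprod := mul_le_mul hu hv (hg.nonneg v) ((hg.nonneg u).trans hu)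
    linarith [(abs_le.1 (hdiff u v)).2]

end Assumptions

end RNW

theorem mainTheorem4_general {Ω : Type*} [MeasurableSpace Ω] {μ : Measure Ω}
    [IsProbabilityMeasure μ] {w : ℕ} {X : ℕ → Ω → EuclideanSpace ℝ (Fin w)} {Y : ℕ → Ω → ℝ}
    {κ : Kernel (EuclideanSpace ℝ (Fin w)) ℝ} [IsMarkovKernel κ]
    {g : EuclideanSpace ℝ (Fin w) → ℝ} {x : EuclideanSpace ℝ (Fin w)}
    (hS : RNW.LocallyRegularSample μ X Y κ g x) (hg : 0 < g x)
    (hcont : ∀ y, ContinuousAt (RNW.condCDF κ y) x) {K : EuclideanSpace ℝ (Fin w) → ℝ}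
    (hK : RNW.IsCenteredKernel K) {h : ℕ → ℝ} (hh : Tendsto h atTop (𝓝[>] 0))
    (hnh : Tendsto (fun n : ℕ => n * h n ^ w) atTop atTop) {β : ℝ} (hβ : 0 < β)
    (huniq : ∀ y, RNW.quantile (fun b => RNW.condCDF κ b x) β < y → β < RNW.condCDF κ y x) :
    TendstoInMeasure μ
      (fun (n : ℕ) (ω : Ω) =>
        RNW.estQuantile K (h n) (fun i : Fin n => X i ω) (fun i : Fin n => Y i ω) x β)
      atTop (fun _ => RNW.quantile (fun b => RNW.condCDF κ b x) β) := by
  refine RNW.tendstoInMeasure_const_iff.2 (Metric.tendsto_nhds.2 fun ε hε => ?_)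
  have hlim (b : ℝ) := hS.tendsto_estCDF hg hK hh hnh (hcont b)
  filter_upwards [(hlim _).eventually_lt_const
      (RNW.condCDF_lt_of_lt_quantile hβ (sub_lt_self _ (half_pos hε))),
    (hlim _).eventually_const_lt (huniq _ (lt_add_of_pos_right _ (half_pos hε))),
    RNW.tendsto_fst_highProbability.eventually (hh.eventually self_mem_nhdsWithin)]
    with z hbelow habove hh_z
  exact (RNW.abs_quantile_sub_le (RNW.estCDF_mono hK.nonneg hh_z) hbelow habove.le).trans_lt
    (half_lt_self hε)

theorem mainTheorem4
    {Ω : Type*} [MeasurableSpace Ω] (μ : Measure Ω) [IsProbabilityMeasure μ]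
    (w : ℕ) (hw : 1 ≤ w)
    -- the data: `n` observations are `(X i, Y i)`, `i = 0, …, n - 1`
    (X : ℕ → Ω → EuclideanSpace ℝ (Fin w)) (Y : ℕ → Ω → ℝ)
    (hX : ∀ i, Measurable (X i)) (hY : ∀ i, Measurable (Y i))
    (δ : ℝ) (hδ : 0 < δ)
    (hmix : RNW.MixingAssumption (fun i ω => (X i ω, Y i ω)) μ δ)
    -- the conditional law of `Y i` given `X i`, and the density of `X i`
    (κ : Kernel (EuclideanSpace ℝ (Fin w)) ℝ) [IsMarkovKernel κ]
    (hκ : HasCondDistrib (Y 0) (X 0) κ μ)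
    (g : EuclideanSpace ℝ (Fin w) → ℝ) (hg : RNW.IsDensity (μ.map (X 0)) g)
    (x : EuclideanSpace ℝ (Fin w))
    (hsmooth : RNW.SmoothnessAssumption μ X κ g x)
    (K : EuclideanSpace ℝ (Fin w) → ℝ) (hK : RNW.KernelAssumption K)
    (h : ℕ → ℝ) (hh : RNW.BandwidthAssumption w δ h)
    (β : ℝ) (hβ : β ∈ Set.Ioo (0 : ℝ) 1)
    -- uniqueness of the conditional `β`-quantile at `x`
    (huniq : ∀ y : ℝ, RNW.quantile (fun b => RNW.condCDF κ b x) β < y → β < RNW.condCDF κ y x) :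
    TendstoInMeasure μ
      (fun (n : ℕ) (ω : Ω) =>
        RNW.estQuantile K (h n) (fun i : Fin n => X i ω) (fun i : Fin n => Y i ω) x β)
      atTop
      (fun _ => RNW.quantile (fun b => RNW.condCDF κ b x) β) := by
  exact mainTheorem4_general
    ⟨hX, hY, hmix.stationary, hmix.summable_sqrt_mixingCoeff hδ, hκ, hsmooth.hasLocalDensities hg⟩
    hsmooth.density_pos (fun y => (hsmooth.cdf_smooth y).continuousAt) hK.isCenteredKernel
    hh.tendsto_nhdsGT (hh.tendsto_mul_pow hδ) hβ.1 huniq
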